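/- Let $R_b,m,a,\lambda,\lambda_P>0$. The communication range of a vehicle (VU) at $x\in\mathbb R$ is the one-dimensional ball $b(x,R_b/2)=[x-R_b/2,\,x+R_b/2]$, of total length $R_b$. In the non-platooned scenario (N-PTS) the VUs form a homogeneous Poisson point process on $\mathbb R$ of density $\lambda$. In the platooned scenario (PTS) they form a Matérn cluster process: the parents form a homogeneous Poisson process of density $\lambda_P$, and independently each parent $x$ has a Poisson number, with mean $m$, of daughters placed independently and uniformly in $[x-a,x+a]$; the VUs are the daughters of all parents. The connectivity degree, $\widetilde N_N$ under N-PTS and $\widetilde N_P$ under PTS, is the number of other VUs in the communication range of the typical VU, that is, the number of points in $b(0,R_b/2)$ under the reduced Palm distribution of the VU process (the typical VU is at the origin and is not counted). Let $\mathcal A(r,a,x)$ be the length of the intersection of two one-dimensional balls of radii $r$ and $a$ with centres at distance $x$, let $\bar{\mathcal A}=\mathcal A/(2a)$, and let $$g(s,r)=2\lambda_P\Big(\int_0^{r+a}e^{m\bar{\mathcal A}(r,a,x)(s-1)}\,dx-(r+a)\Big),\qquad g_i(r)=\int_0^{r+a}2\lambda_P\,(m\bar{\mathcal A}(r,a,x))^i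 e^{-m\bar{\mathcal A}(r,a,x)}\,dx\quad(i\ge1).$$ (1) Under N-PTS, $\mathbb E[s^{\widetilde N_N}]=\exp(\lambda R_b(s-1))$ for all real $s$, and $\mathbb P[\widetilde N_N=k]=\frac{1}{k!}(\lambda R_b)^k e^{-\lambda R_b}$ for all $k\ge0$. (2) Under PTS, the number $S(R_b/2)$ of points of the Matérn cluster process in any ball of radius $R_b/2$ has PGF $\mathcal P_{S(R_b/2)}(s)=e^{g(s,R_b/2)}$ for all real $s$ and PMF $$p_{S(R_b/2)}(k)=\frac{e^{g(0,R_b/2)}}{k!}\sum_{\substack{b_1,\dots,b_k\ge0\\ b_1+2b_2+\dots+kb_k=k}}\frac{k!}{b_1!\cdots b_k!}\prod_{i=1}^k\Big(\frac{g_i(R_b/2)}{i!}\Big)^{b_i},\qquad k\ge0,$$ and the connectivity degree satisfies, for all real $s$, $$\mathbb E[s^{\widetilde N_P}]=\mathcal P_{S(R_b/2)}(s)\cdot\frac1a\int_0^a e^{m\bar{\mathcal A}(R_b/2,a,x)(s-1)}\,dx$$ and, for all $k\ge0$, $$\mathbb P[\widetilde N_P=k]=\frac1{k!}\sum_{n=0}^k\binom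 kn (k-n)!\,p_{S(R_b/2)}(k-n)\,\frac1a\int_0^a\big(m\bar{\mathcal A}(R_b/2,a,x)\big)^n e^{-m\bar{\mathcal A}(R_b/2,a,x)}\,dx .$$ -/

import Mathlib

open MeasureTheory ProbabilityTheory
open scoped ENNReal

noncomputable section

/-- A point process on the real line, given through a measurable labelling of its points:
`loc i` is the position of the point with label `i`, which is really there on the event
`present i`. Points are counted with multiplicity. -/
structure PointProcess (Ω : Type*) [MeasurableSpace Ω] (ι : Type*) where
  loc : ι → Ω → ℝ
  present : ι → Set Ω
  measurable_loc : ∀ i, Measurable (loc i)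
  measurableSet_present : ∀ i, MeasurableSet (present i)

namespace PointProcess

variable {Ω : Type*} [MeasurableSpace Ω] {ι : Type*}

/-- The realization of the process as a counting measure: a unit mass at each point. -/
def config (Φ : PointProcess Ω ι) (ω : Ω) : Measure ℝ :=
  Measure.sum fun i => (Φ.present i).indicator (fun ω' => Measure.dirac (Φ.loc i ω')) ω

/-- All points other than the one labelled `i`, after the translation that moves the
point labelled `i` to the origin. -/
def othersSeenFrom (Φ : PointProcess Ω ι) (i : ι) (ω : Ω) : Measure ℝ :=
  Measure.sum fun j : {j : ι // j ≠ i} =>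
    (Φ.present j).indicator (fun ω' => Measure.dirac (Φ.loc j ω' - Φ.loc i ω')) ω

/-- The mean number of points in `B`. -/
def meanCount (Φ : PointProcess Ω ι) (P : Measure Ω) (B : Set ℝ) : ℝ≥0∞ :=
  ∫⁻ ω, Φ.config ω B ∂P

/-- The reduced Palm distribution: the law of the remaining points, seen from the typical
point placed at the origin. It is the average of the configurations of the other points seen
from `x` over the points `x` of the process in a window `B`:
`Q(A) = E[∑_{x ∈ Φ ∩ B} 1((Φ \ {x}) - x ∈ A)] / E[Φ(B)]`.
For a stationary process it does not depend on the window. -/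
def reducedPalm (Φ : PointProcess Ω ι) (P : Measure Ω) (B : Set ℝ) : Measure (Measure ℝ) :=
  (Φ.meanCount P B)⁻¹ • Measure.sum fun i =>
    (P.restrict (Φ.present i ∩ Φ.loc i ⁻¹' B)).map (Φ.othersSeenFrom i)

/-- Homogeneous Poisson point process of density `lam` on the line: the number of points in
a Borel set of finite length is Poisson distributed with mean `lam` times the length, and the
numbers of points in disjoint Borel sets are independent. -/
structure IsPoisson (Φ : PointProcess Ω ι) (P : Measure Ω) (lam : ℝ) : Prop where
  count_law : ∀ B : Set ℝ, MeasurableSet B → volume B ≠ ∞ →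
    P.map (fun ω => Φ.config ω B) =
      (poissonMeasure (lam * volume.real B).toNNReal).map (fun n : ℕ => (n : ℝ≥0∞))
  count_indep : ∀ (n : ℕ) (B : Fin n → Set ℝ), (∀ i, MeasurableSet (B i)) →
    Pairwise (fun i j => Disjoint (B i) (B j)) →
    iIndepFun (fun i ω => Φ.config ω (B i)) P

end PointProcess

/-- The data of a one-dimensional Matérn cluster process: the parents form a Poisson process
of density `lamP`; the parent labelled `i` has `size i` daughters, a Poisson variable
of mean `m`; the `j`-th daughter of parent `i` sits at the position of the parent
plus `offset (i, j)`, uniform on the ball of radius `a` about the origin; all sizes and offsets are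
independent, and independent of the parents. -/
structure MaternCluster {Ω : Type*} [MeasurableSpace Ω] (P : Measure Ω) (κ : Type*)
    (lamP m a : ℝ) where
  parents : PointProcess Ω κ
  parents_poisson : parents.IsPoisson P lamP
  size : κ → Ω → ℕ
  offset : κ × ℕ → Ω → ℝ
  measurable_size : ∀ i, Measurable (size i)
  measurable_offset : ∀ p, Measurable (offset p)
  size_law : ∀ i, P.map (size i) = poissonMeasure m.toNNReal
  offset_law : ∀ p, pdf.IsUniform (offset p) (Metric.closedBall (0 : ℝ) a) P volume
  size_indep : iIndepFun size P
  offset_indep : iIndepFun offset P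
  size_indep_offset : IndepFun (fun ω i => size i ω) (fun ω p => offset p ω) P
  parents_indep : IndepFun (fun ω i => (parents.loc i ω, ω ∈ parents.present i))
    (fun ω => ((fun i => size i ω), (fun p => offset p ω))) P

/-- The Matérn cluster process itself: the union of all daughter processes. The daughter
labelled `(i, j)` is there when its parent is and `j < size i` (daughters are numbered
from `0`). -/
def MaternCluster.points {Ω : Type*} [MeasurableSpace Ω] {P : Measure Ω} {κ : Type*}
    {lamP m a : ℝ} (M : MaternCluster P κ lamP m a) : PointProcess Ω (κ × ℕ) where
  loc p ω := M.parents.loc p.1 ω + M.offset p ω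
  present p := M.parents.present p.1 ∩ {ω | p.2 < M.size p.1 ω}
  measurable_loc p := (M.parents.measurable_loc p.1).add (M.measurable_offset p)
  measurableSet_present p := (M.parents.measurableSet_present p.1).inter
    (measurableSet_lt measurable_const (M.measurable_size p.1))

/-- Probability generating function: `N`, under the law `Q`, takes the value `k` with
probability `Q {N = k}`, and `∑ₖ Q {N = k} sᵏ` converges for every real `s`, to `G s`. -/
def HasPGF {S : Type*} [MeasurableSpace S] (Q : Measure S) (N : S → ℝ≥0∞) (G : ℝ → ℝ) : Prop :=
  ∀ s : ℝ, HasSum (fun k : ℕ => Q.real {x | N x = k} * s ^ k) (G s)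

/-- Probability mass function of a count `N` under the law `Q`. -/
def HasPMF {S : Type*} [MeasurableSpace S] (Q : Measure S) (N : S → ℝ≥0∞) (p : ℕ → ℝ) : Prop :=
  ∀ k : ℕ, Q.real {x | N x = k} = p k

/-- Number of points within the communication range of a vehicle at the origin. The range
is the one-dimensional ball of length `Rb`, that is, of radius `Rb / 2`. -/
def connectivityDegree (Rb : ℝ) (μ : Measure ℝ) : ℝ≥0∞ :=
  μ (Metric.closedBall (0 : ℝ) (Rb / 2))

/-- Length of the intersection of two one-dimensional balls of radii `r` and `a` whose
centres are `x` apart. -/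
def overlap (r a x : ℝ) : ℝ :=
  volume.real (Metric.closedBall (0 : ℝ) r ∩ Metric.closedBall x a)

/-- The overlap, normalized by the length `2 a`. -/
def overlapBar (r a x : ℝ) : ℝ := overlap r a x / (2 * a)

/-- The exponent in the generating function of the number of points of a Matérn cluster process
in a ball of radius `r`. -/
def mcpExponent (lamP m a s r : ℝ) : ℝ :=
  2 * lamP * ((∫ x in (0 : ℝ)..(r + a), Real.exp (m * overlapBar r a x * (s - 1))) - (r + a))

/-- The derivative of order `i ≥ 1` of the exponent in `s`, at `s = 0`. -/
def mcpExponentDeriv (lamP m a : ℝ) (i : ℕ) (r : ℝ) : ℝ :=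
  ∫ x in (0 : ℝ)..(r + a),
    2 * lamP * (m * overlapBar r a x) ^ i * Real.exp (-(m * overlapBar r a x))

/-- The tuples `(b₁, …, bₖ)` of natural numbers with `b₁ + 2 b₂ + ⋯ + k bₖ = k`; the entry
`b i` with `i : Fin k` is the one of index `i + 1`. -/
def faaDiBrunoTuples (k : ℕ) : Finset (Fin k → ℕ) :=
  (Fintype.piFinset fun _ => Finset.range (k + 1)).filter
    fun b => ∑ i : Fin k, ((i : ℕ) + 1) * b i = k

/-- The mass function of the number of points of a Matérn cluster process in a ball
of radius `r`. -/
def mcpPMF (lamP m a r : ℝ) (k : ℕ) : ℝ :=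
  Real.exp (mcpExponent lamP m a 0 r) / (k.factorial : ℝ) *
    ∑ b ∈ faaDiBrunoTuples k,
      (k.factorial : ℝ) / (∏ i : Fin k, ((b i).factorial : ℝ)) *
        ∏ i : Fin k,
          (mcpExponentDeriv lamP m a ((i : ℕ) + 1) r / (((i : ℕ) + 1).factorial : ℝ)) ^ b i

end

/-! Everything is computed through Laplace transforms. Independence of counts gives the Poisson
functional `E exp(-∫ f dΦ) = exp(-λ ∫ (1 - exp(-f)))`. For the cluster process, integrating out
offsets and sizes first turns each parent at `x` into a factor `exp(-m (1 - L x))`, with `L x` the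
transform of one daughter, and the Poisson functional of the parents does the rest
(`lintegral_expNeg_points`).

Palm averages are derivatives of these functionals: `E[Φ(B) exp(-t Φ(D))]` is minus the derivative
at `τ = 0` of the transform of `t 1_D + τ 1_B`. Splitting `B` along `D` makes the contribution of
the counted point itself constant, so it can be divided out (`palmLaplace_eq_setLIntegral`). For the
Poisson process the other points keep the original law. For the cluster process a second factor
appears: the siblings of the typical point, whose parent lies at a uniform offset from it.

This treats a fixed set `D`, whereas the communication range moves with the point.
`PointProcess.neighbourLaplace_eq` cuts the window into short cells, compares the moving ball with
fixed balls of slightly larger or smaller radius, and concludes by continuity in the radius.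

Finally, with `s = exp(-t)`, the transform on `0 < s < 1` determines the mass function
(`hasPGF_and_hasPMF_of_lintegral_expNeg`). The closed forms are coefficients of power series: Faà di
Bruno for the exponential of `g`, and a Cauchy product for the additional sibling factor. -/

open Filter Topology Set

/-! ### Laplace transforms on `[0, ∞]` -/

/-- The function `exp (-x)` on `[0, ∞]`, with value `0` at `∞`. -/
noncomputable def expNeg (x : ℝ≥0∞) : ℝ≥0∞ := (EReal.exp (x : EReal))⁻¹

theorem expNeg_zero : expNeg 0 = 1 := by simp [expNeg]

theorem expNeg_top : expNeg ∞ = 0 := by simp [expNeg]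

theorem expNeg_add (x y : ℝ≥0∞) : expNeg (x + y) = expNeg x * expNeg y := by
  have h : ∀ z : ℝ≥0∞, EReal.exp (z : EReal) ≠ 0 := fun z => by simp
  unfold expNeg
  rw [EReal.coe_ennreal_add, EReal.exp_add, ENNReal.mul_inv (.inl (h x)) (.inr (h y))]

theorem expNeg_ofReal {x : ℝ} (hx : 0 ≤ x) :
    expNeg (ENNReal.ofReal x) = ENNReal.ofReal (Real.exp (-x)) := by
  rw [expNeg, EReal.coe_ennreal_ofReal, max_eq_left hx, EReal.exp_coe,
    ← ENNReal.ofReal_inv_of_pos (Real.exp_pos _), Real.exp_neg]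

theorem expNeg_antitone : Antitone expNeg := fun x y h =>
  ENNReal.inv_le_inv.2 (EReal.exp_monotone (by exact_mod_cast h))

theorem expNeg_le_one (x : ℝ≥0∞) : expNeg x ≤ 1 := by
  simpa [expNeg_zero] using expNeg_antitone (zero_le : (0 : ℝ≥0∞) ≤ x)

theorem expNeg_ne_top (x : ℝ≥0∞) : expNeg x ≠ ∞ := ne_top_of_le_ne_top (by simp) (expNeg_le_one x)

theorem expNeg_ne_zero {x : ℝ≥0∞} (hx : x ≠ ∞) : expNeg x ≠ 0 := by
  simpa [expNeg] using hx

theorem continuous_expNeg : Continuous expNeg :=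
  (ENNReal.continuous_exp.comp continuous_coe_ennreal_ereal).inv

theorem measurable_expNeg : Measurable expNeg := continuous_expNeg.measurable

/-- Lets a transform such as `daughterLaplace` be written as an exponential, so that infinite
products of transforms become exponentials of sums. -/
theorem exists_expNeg_eq {y : ℝ≥0∞} (hy : y ≤ 1) : ∃ x, expNeg x = y := by
  refine ⟨(ENNReal.log y⁻¹).toENNReal, ?_⟩
  have : 0 ≤ ENNReal.log y⁻¹ := by
    rw [ENNReal.zero_le_log_iff]
    simpa using hy
  rw [expNeg, EReal.coe_toENNReal this, ENNReal.exp_log, inv_inv]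

theorem expNeg_sum {ι : Type*} (s : Finset ι) (f : ι → ℝ≥0∞) :
    expNeg (∑ i ∈ s, f i) = ∏ i ∈ s, expNeg (f i) := by
  classical
  induction s using Finset.induction_on with
  | empty => simp [expNeg_zero]
  | insert i s hi ih => rw [Finset.sum_insert hi, Finset.prod_insert hi, expNeg_add, ih]

theorem expNeg_nat_mul (n : ℕ) (x : ℝ≥0∞) : expNeg (n * x) = expNeg x ^ n := by
  have := expNeg_sum (Finset.range n) (fun _ => x)
  simpa using this

/-- The Laplace transform of a countable sum of independent variables. -/
theorem lintegral_expNeg_tsum {Ω : Type*} [MeasurableSpace Ω] {P : Measure Ω} {ι : Type*}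
    [Countable ι] {β : Type*} [MeasurableSpace β] {Y : ι → Ω → β}
    (hY : iIndepFun Y P) (hm : ∀ i, Measurable (Y i)) {g : ι → β → ℝ≥0∞}
    (hg : ∀ i, Measurable (g i)) {c : ι → ℝ≥0∞}
    (h : ∀ i, ∫⁻ ω, expNeg (g i (Y i ω)) ∂P = expNeg (c i)) :
    ∫⁻ ω, expNeg (∑' i, g i (Y i ω)) ∂P = expNeg (∑' i, c i) := by
  have : IsProbabilityMeasure P := hY.isProbabilityMeasure
  have hfin : ∀ s : Finset ι, ∫⁻ ω, expNeg (∑ i ∈ s, g i (Y i ω)) ∂P = expNeg (∑ i ∈ s, c i) := by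
    intro s
    simp_rw [expNeg_sum, ← h]
    exact lintegral_prod_eq_prod_lintegral_of_indepFun s (fun i ω => expNeg (g i (Y i ω)))
      (hY.comp (fun i b => expNeg (g i b)) fun i => measurable_expNeg.comp (hg i))
      fun i => measurable_expNeg.comp ((hg i).comp (hm i))
  -- Continuity of `expNeg` at `∞` as well as at finite points makes both limits valid even for
  -- divergent sums.
  have h1 : Tendsto (fun s : Finset ι => expNeg (∑ i ∈ s, c i)) atTop (𝓝 (expNeg (∑' i, c i))) :=
    (continuous_expNeg.tendsto _).comp ENNReal.summable.hasSum
  have h2 : Tendsto (fun s : Finset ι => ∫⁻ ω, expNeg (∑ i ∈ s, g i (Y i ω)) ∂P) atTop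
      (𝓝 (∫⁻ ω, expNeg (∑' i, g i (Y i ω)) ∂P)) := by
    refine tendsto_lintegral_filter_of_dominated_convergence (fun _ => 1) ?_ ?_ (by simp) ?_
    · exact .of_forall fun s => measurable_expNeg.comp
        (Finset.measurable_sum s fun i _ => (hg i).comp (hm i))
    · exact .of_forall fun s => .of_forall fun ω => expNeg_le_one _
    · exact .of_forall fun ω => (continuous_expNeg.tendsto _).comp ENNReal.summable.hasSum
  simp_rw [hfin] at h2
  exact tendsto_nhds_unique h2 h1

/-- The Laplace transform of a Poisson variable. -/
theorem lintegral_expNeg_poissonMeasure (r : NNReal) (y : ℝ≥0∞) :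
    ∫⁻ n : ℕ, expNeg (n * y) ∂(poissonMeasure r) = expNeg (r * (1 - expNeg y)) := by
  simp_rw [expNeg_nat_mul]
  obtain ⟨σ, hσ⟩ : ∃ σ : NNReal, expNeg y = σ := ⟨_, (ENNReal.coe_toNNReal (expNeg_ne_top y)).symm⟩
  have hσ1 : (σ : ℝ) ≤ 1 := by
    have := expNeg_le_one y
    rw [hσ] at this
    exact_mod_cast this
  rw [hσ, poissonMeasure, lintegral_sum_measure]
  simp_rw [lintegral_smul_measure, lintegral_dirac]
  have e1 : ∀ n : ℕ, ENNReal.ofReal (Real.exp (-r) * r ^ n / n.factorial) • (σ : ℝ≥0∞) ^ n =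
      ENNReal.ofReal (Real.exp (-r) * ((r * σ : ℝ) ^ n / n.factorial)) := by
    intro n
    rw [smul_eq_mul, ← ENNReal.ofReal_coe_nnreal (p := σ), ← ENNReal.ofReal_pow σ.coe_nonneg,
      ← ENNReal.ofReal_mul (by positivity)]
    congr 1
    rw [mul_pow]
    ring
  simp_rw [e1]
  have hs := (NormedSpace.expSeries_div_hasSum_exp (r * σ : ℝ)).mul_left (Real.exp (-r))
  rw [← Real.exp_eq_exp_ℝ, ← Real.exp_add] at hs
  rw [← ENNReal.ofReal_tsum_of_nonneg (fun n => by positivity) hs.summable, hs.tsum_eq]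
  have e2 : (r : ℝ≥0∞) * (1 - σ) = ENNReal.ofReal (r * (1 - σ)) := by
    rw [ENNReal.ofReal_mul r.coe_nonneg, ENNReal.ofReal_sub _ σ.coe_nonneg]
    simp
  rw [e2, expNeg_ofReal (mul_nonneg r.coe_nonneg (by linarith))]
  congr 2
  ring

/-! ### Counts and the Laplace functional of a Poisson process -/

namespace PointProcess

variable {Ω : Type*} [MeasurableSpace Ω] {ι : Type*}

theorem lintegral_config (Φ : PointProcess Ω ι) {f : ℝ → ℝ≥0∞} (hf : Measurable f) (ω : Ω) :
    ∫⁻ x, f x ∂(Φ.config ω) = ∑' i, (Φ.present i).indicator (fun ω' => f (Φ.loc i ω')) ω := by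
  rw [config, lintegral_sum_measure]
  congr with i
  by_cases h : ω ∈ Φ.present i
  · simp [h, lintegral_dirac' _ hf]
  · simp [h]

theorem config_apply (Φ : PointProcess Ω ι) {D : Set ℝ} (hD : MeasurableSet D) (ω : Ω) :
    Φ.config ω D = ∑' i, (Φ.present i).indicator (fun ω' => D.indicator 1 (Φ.loc i ω')) ω := by
  rw [← lintegral_indicator_one hD, lintegral_config Φ (measurable_one.indicator hD)]

theorem measurable_lintegral_config [Countable ι] (Φ : PointProcess Ω ι) {f : ℝ → ℝ≥0∞}
    (hf : Measurable f) : Measurable fun ω => ∫⁻ x, f x ∂(Φ.config ω) := by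
  simp_rw [Φ.lintegral_config hf]
  exact Measurable.tsum fun i =>
    (hf.comp (Φ.measurable_loc i)).indicator (Φ.measurableSet_present i)

theorem measurable_config_apply [Countable ι] (Φ : PointProcess Ω ι) {D : Set ℝ}
    (hD : MeasurableSet D) : Measurable fun ω => Φ.config ω D := by
  simpa [lintegral_indicator_one hD] using
    Φ.measurable_lintegral_config (measurable_one.indicator hD)

variable [Countable ι] {P : Measure Ω} {Φ : PointProcess Ω ι} {lam : ℝ}

/-- The Laplace transform of a single count of a Poisson process. -/
theorem IsPoisson.lintegral_expNeg_count (h : Φ.IsPoisson P lam) {D : Set ℝ}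
    (hD : MeasurableSet D) (hD' : volume D ≠ ∞) (y : ℝ≥0∞) :
    ∫⁻ ω, expNeg (y * Φ.config ω D) ∂P =
      expNeg (ENNReal.ofReal lam * ((1 - expNeg y) * volume D)) := by
  have hm : Measurable fun x : ℝ≥0∞ => expNeg (y * x) :=
    measurable_expNeg.comp (measurable_const.mul measurable_id)
  rw [← lintegral_map (f := fun x => expNeg (y * x)) hm (Φ.measurable_config_apply hD),
    h.count_law D hD hD', lintegral_map hm (measurable_of_countable _)]
  simp_rw [mul_comm y]
  rw [lintegral_expNeg_poissonMeasure]
  congr 1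
  rw [ENNReal.ofNNReal_toNNReal, ENNReal.ofReal_mul' measureReal_nonneg,
    ofReal_measureReal hD', mul_assoc, mul_comm (volume D)]

/-- The Laplace functional of a Poisson process at a simple function. -/
theorem IsPoisson.lintegral_expNeg_simpleFunc [IsProbabilityMeasure P] (h : Φ.IsPoisson P lam)
    (g : SimpleFunc ℝ ℝ≥0∞) (hg : ∀ c ≠ 0, volume (g ⁻¹' {c}) ≠ ∞) :
    ∫⁻ ω, expNeg (∫⁻ x, g x ∂(Φ.config ω)) ∂P =
      expNeg (ENNReal.ofReal lam * ∫⁻ x, (1 - expNeg (g x))) := by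
  let B : g.range → Set ℝ := fun c => g ⁻¹' {(c : ℝ≥0∞)}
  have hB : ∀ c, MeasurableSet (B c) := fun c => g.measurableSet_preimage _
  have hind : iIndepFun (fun (c : g.range) ω => Φ.config ω (B c)) P := by
    have h1 := h.count_indep _ (fun i => B (g.range.equivFin.symm i)) (fun i => hB _) (by
      intro i j hij
      refine Disjoint.preimage _ ?_
      rw [disjoint_singleton]
      exact fun e => hij (g.range.equivFin.symm.injective (Subtype.ext e)))
    simpa using h1.precomp g.range.equivFin.injective
  have key := lintegral_expNeg_tsum hind (fun c => Φ.measurable_config_apply (hB c))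
    (g := fun c x => (c : ℝ≥0∞) * x)
    (c := fun c => ENNReal.ofReal lam * ((1 - expNeg c) * volume (B c)))
    (fun c => measurable_const.mul measurable_id) (by
      intro c
      -- The level set of `0` may have infinite length, but there both sides equal `1`.
      by_cases hc : (c : ℝ≥0∞) = 0
      · simp [hc, expNeg_zero]
      · exact h.lintegral_expNeg_count (hB c) (hg c hc) c)
  have e1 : ∀ ω, ∫⁻ x, g x ∂(Φ.config ω) = ∑' c : g.range, (c : ℝ≥0∞) * Φ.config ω (B c) := by
    intro ω
    rw [SimpleFunc.lintegral_eq_lintegral, SimpleFunc.lintegral, tsum_fintype,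
      ← Finset.sum_coe_sort]
  have e2 : ∫⁻ x, (1 - expNeg (g x)) = ∑' c : g.range, (1 - expNeg c) * volume (B c) := by
    have := SimpleFunc.lintegral_eq_lintegral (g.map fun c => 1 - expNeg c) volume
    rw [SimpleFunc.map_lintegral] at this
    rw [tsum_fintype, Finset.sum_coe_sort g.range (fun c => (1 - expNeg c) * volume (g ⁻¹' {c})),
      ← this]
    simp
  simp_rw [e1, e2, key, ENNReal.tsum_mul_left]

/-- The Laplace functional of a homogeneous Poisson process. -/
theorem IsPoisson.lintegral_expNeg [IsProbabilityMeasure P] (h : Φ.IsPoisson P lam)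
    {f : ℝ → ℝ≥0∞} (hf : Measurable f) :
    ∫⁻ ω, expNeg (∫⁻ x, f x ∂(Φ.config ω)) ∂P =
      expNeg (ENNReal.ofReal lam * ∫⁻ x, (1 - expNeg (f x))) := by
  let s : ℕ → Set ℝ := fun n => Icc (-(n : ℝ)) n
  have hs : ∀ n, MeasurableSet (s n) := fun n => measurableSet_Icc
  have hsm : Monotone s := fun m n hmn => by
    have : (m : ℝ) ≤ n := by exact_mod_cast hmn
    exact Icc_subset_Icc (by linarith) this
  -- Restriction to `[-n, n]` makes every nonzero level set of finite length, as the law of the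
  -- counts requires.
  let g : ℕ → SimpleFunc ℝ ℝ≥0∞ := fun n => (SimpleFunc.eapprox f n).restrict (s n)
  have hgx : ∀ n x, g n x = (s n).indicator (SimpleFunc.eapprox f n) x := fun n x => by
    rw [SimpleFunc.restrict_apply _ (hs n)]
  have hgm : ∀ x, Monotone fun n => g n x := by
    intro x m n hmn
    simp only [hgx]
    exact (indicator_le_indicator (SimpleFunc.monotone_eapprox f hmn x)).trans
      (indicator_le_indicator_of_subset (hsm hmn) (fun _ => zero_le) x)
  have hgt : ∀ x, Tendsto (fun n => g n x) atTop (𝓝 (f x)) := by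
    intro x
    have h1 : Tendsto (fun n => SimpleFunc.eapprox f n x) atTop (𝓝 (f x)) := by
      rw [← SimpleFunc.iSup_eapprox_apply hf x]
      exact tendsto_atTop_iSup fun m n hmn => SimpleFunc.monotone_eapprox f hmn x
    refine h1.congr' ?_
    obtain ⟨N, hN⟩ := exists_nat_ge |x|
    filter_upwards [eventually_ge_atTop N] with n hn
    have : (N : ℝ) ≤ n := by exact_mod_cast hn
    rw [hgx, indicator_of_mem]
    exact abs_le.1 (hN.trans this)
  have hfin : ∀ n, ∀ c ≠ 0, volume ((g n) ⁻¹' {c}) ≠ ∞ := by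
    intro n c hc
    refine measure_ne_top_of_subset (s := s n) ?_ (by simp [s])
    intro x hx
    by_contra hxs
    apply hc
    rw [← (show g n x = c from hx), hgx, indicator_of_notMem hxs]
  have hconf : ∀ μ : Measure ℝ, Tendsto (fun n => ∫⁻ x, g n x ∂μ) atTop (𝓝 (∫⁻ x, f x ∂μ)) :=
    fun μ => lintegral_tendsto_of_tendsto_of_monotone (fun n => (g n).measurable.aemeasurable)
      (.of_forall hgm) (.of_forall hgt)
  have hL : Tendsto (fun n => ∫⁻ ω, expNeg (∫⁻ x, g n x ∂(Φ.config ω)) ∂P) atTop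
      (𝓝 (∫⁻ ω, expNeg (∫⁻ x, f x ∂(Φ.config ω)) ∂P)) :=
    tendsto_lintegral_of_dominated_convergence (fun _ => 1)
      (fun n => measurable_expNeg.comp (Φ.measurable_lintegral_config (g n).measurable))
      (fun n => .of_forall fun ω => expNeg_le_one _) (by simp)
      (.of_forall fun ω => (continuous_expNeg.tendsto _).comp (hconf _))
  have hR : Tendsto (fun n => expNeg (ENNReal.ofReal lam * ∫⁻ x, (1 - expNeg (g n x)))) atTop
      (𝓝 (expNeg (ENNReal.ofReal lam * ∫⁻ x, (1 - expNeg (f x))))) := by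
    refine (continuous_expNeg.tendsto _).comp
      (ENNReal.Tendsto.const_mul ?_ (.inr ENNReal.ofReal_ne_top))
    refine lintegral_tendsto_of_tendsto_of_monotone
      (fun n => (measurable_const.sub (measurable_expNeg.comp (g n).measurable)).aemeasurable)
      (.of_forall fun x m n hmn => tsub_le_tsub_left (expNeg_antitone (hgm x hmn)) _)
      (.of_forall fun x => ?_)
    exact ENNReal.Tendsto.sub tendsto_const_nhds ((continuous_expNeg.tendsto _).comp (hgt x))
      (.inl (by simp))
  simp_rw [h.lintegral_expNeg_simpleFunc (g _) (hfin _)] at hL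
  exact tendsto_nhds_unique hL hR

end PointProcess

/-! ### The Laplace functional of a Matérn cluster process -/

/-- Integration of a function of two independent variables, one variable at a time. -/
theorem lintegral_indepFun {Ω α β : Type*} [MeasurableSpace Ω] [MeasurableSpace α]
    [MeasurableSpace β] {P : Measure Ω} [IsProbabilityMeasure P] {X : Ω → α} {Y : Ω → β}
    (h : IndepFun X Y P) (hX : Measurable X) (hY : Measurable Y) {F : α × β → ℝ≥0∞}
    (hF : Measurable F) :
    ∫⁻ ω, F (X ω, Y ω) ∂P = ∫⁻ ω, ∫⁻ ω', F (X ω, Y ω') ∂P ∂P := by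
  rw [← lintegral_map (f := F) (g := fun ω => (X ω, Y ω)) hF (hX.prodMk hY),
    (indepFun_iff_map_prod_eq_prod_map_map hX.aemeasurable hY.aemeasurable).1 h,
    lintegral_prod _ hF.aemeasurable, lintegral_map hF.lintegral_prod_right' hX]
  congr with ω
  exact lintegral_map (hF.comp measurable_prodMk_left) hY

namespace MaternCluster

variable {Ω : Type*} [MeasurableSpace Ω] {P : Measure Ω} {κ : Type*} {lamP m a : ℝ}

/-- The Laplace transform of the contribution of one daughter of a parent at `x`. -/
noncomputable def daughterLaplace (a : ℝ) (f : ℝ → ℝ≥0∞) (x : ℝ) : ℝ≥0∞ :=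
  ∫⁻ u, expNeg (f (x + u)) ∂(cond volume (Metric.closedBall (0 : ℝ) a))

theorem isProbabilityMeasure_cond_closedBall (ha : 0 < a) :
    IsProbabilityMeasure (cond volume (Metric.closedBall (0 : ℝ) a)) := by
  apply cond_isProbabilityMeasure_of_finite
  · simpa using ha
  · exact measure_closedBall_lt_top.ne

theorem daughterLaplace_le_one (ha : 0 < a) (f : ℝ → ℝ≥0∞) (x : ℝ) :
    daughterLaplace a f x ≤ 1 := by
  have := isProbabilityMeasure_cond_closedBall ha
  calc daughterLaplace a f x ≤ ∫⁻ _, 1 ∂(cond volume (Metric.closedBall (0 : ℝ) a)) :=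
        lintegral_mono fun u => expNeg_le_one _
    _ = 1 := by simp

theorem measurable_daughterLaplace (ha : 0 < a) {f : ℝ → ℝ≥0∞} (hf : Measurable f) :
    Measurable (daughterLaplace a f) := by
  have := isProbabilityMeasure_cond_closedBall ha
  have : Measurable fun p : ℝ × ℝ => expNeg (f (p.1 + p.2)) :=
    measurable_expNeg.comp (hf.comp (measurable_fst.add measurable_snd))
  exact this.lintegral_prod_right'

theorem lintegral_expNeg_offset (M : MaternCluster P κ lamP m a) {f : ℝ → ℝ≥0∞}
    (hf : Measurable f) (p : κ × ℕ) (x : ℝ) :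
    ∫⁻ ω, expNeg (f (x + M.offset p ω)) ∂P = daughterLaplace a f x := by
  have hm : Measurable fun u => expNeg (f (x + u)) :=
    measurable_expNeg.comp (hf.comp (measurable_const.add measurable_id))
  rw [daughterLaplace, ← M.offset_law p, lintegral_map hm (M.measurable_offset p)]

open Classical in
/-- The Laplace functional of the daughters, given the parents. -/
theorem lintegral_expNeg_daughters [Countable κ] [IsProbabilityMeasure P]
    (M : MaternCluster P κ lamP m a) (ha : 0 < a) {f : ℝ → ℝ≥0∞} (hf : Measurable f)
    (l : κ → ℝ) (q : κ → Prop) :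
    ∫⁻ ω, expNeg (∑' p : κ × ℕ,
        if q p.1 ∧ p.2 < M.size p.1 ω then f (l p.1 + M.offset p ω) else 0) ∂P =
      expNeg (∑' i, if q i then ENNReal.ofReal m * (1 - daughterLaplace a f (l i)) else 0) := by
  -- `ψ` need not be measurable: the parents are frozen, and it is evaluated only at the fixed
  -- positions `l i`.
  choose ψ hψ using fun x => exists_expNeg_eq (daughterLaplace_le_one ha f x)
  -- With the sizes frozen as well, the offsets are independent and each daughter present
  -- contributes one factor `exp(-ψ)`.
  have h1 : ∀ n : κ → ℕ, ∫⁻ ω, expNeg (∑' p : κ × ℕ,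
        if q p.1 ∧ p.2 < n p.1 then f (l p.1 + M.offset p ω) else 0) ∂P =
      expNeg (∑' i, if q i then n i * ψ (l i) else 0) := by
    intro n
    rw [lintegral_expNeg_tsum M.offset_indep M.measurable_offset
      (g := fun p u => if q p.1 ∧ p.2 < n p.1 then f (l p.1 + u) else 0)
      (c := fun p => if q p.1 ∧ p.2 < n p.1 then ψ (l p.1) else 0)]
    · rw [ENNReal.tsum_prod']
      congr 2 with i
      by_cases hi : q i
      · simp only [hi, true_and, if_true]
        rw [tsum_eq_sum (s := Finset.range (n i)) (fun j hj => by
          rw [if_neg (by simpa using hj)]), Finset.sum_congr rfl (fun j hj => by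
          rw [if_pos (by simpa using hj)])]
        simp
      · simp [hi]
    · intro p
      by_cases hp : q p.1 ∧ p.2 < n p.1
      · simp only [hp, and_self, if_true]
        exact hf.comp (measurable_const.add measurable_id)
      · simp only [hp, if_false]
        exact measurable_const
    · intro p
      by_cases hp : q p.1 ∧ p.2 < n p.1
      · simp only [hp, and_self, if_true]
        rw [M.lintegral_expNeg_offset hf, hψ]
      · simp [hp, expNeg_zero]
  have h2 : ∫⁻ ω, expNeg (∑' i, if q i then M.size i ω * ψ (l i) else 0) ∂P =
      expNeg (∑' i, if q i then ENNReal.ofReal m * (1 - daughterLaplace a f (l i)) else 0) := by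
    refine lintegral_expNeg_tsum M.size_indep M.measurable_size
      (g := fun i n => if q i then n * ψ (l i) else 0) (fun i => measurable_of_countable _) ?_
    intro i
    by_cases hi : q i
    · simp only [hi, if_true]
      rw [← lintegral_map (f := fun n : ℕ => expNeg (n * ψ (l i))) (measurable_of_countable _)
        (M.measurable_size i), M.size_law, lintegral_expNeg_poissonMeasure, hψ]
      rfl
    · simp [hi, expNeg_zero]
  have hF : Measurable fun z : (κ → ℕ) × (κ × ℕ → ℝ) => expNeg (∑' p : κ × ℕ,
        if q p.1 ∧ p.2 < z.1 p.1 then f (l p.1 + z.2 p) else 0) := by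
    refine measurable_expNeg.comp (Measurable.tsum fun p => ?_)
    refine Measurable.ite ?_ (hf.comp (by fun_prop)) measurable_const
    exact (MeasurableSet.const _).inter
      (measurableSet_lt measurable_const ((measurable_pi_apply p.1).comp measurable_fst))
  rw [lintegral_indepFun M.size_indep_offset (measurable_pi_lambda _ M.measurable_size)
    (measurable_pi_lambda _ M.measurable_offset) hF, ← h2]
  exact lintegral_congr fun ω => h1 fun i => M.size i ω

open Classical in
/-- The Laplace functional of a Matérn cluster process. -/
theorem lintegral_expNeg_points [Countable κ] [IsProbabilityMeasure P]
    (M : MaternCluster P κ lamP m a) (ha : 0 < a) {f : ℝ → ℝ≥0∞} (hf : Measurable f) :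
    ∫⁻ ω, expNeg (∫⁻ x, f x ∂(M.points.config ω)) ∂P =
      expNeg (ENNReal.ofReal lamP * ∫⁻ x,
        (1 - expNeg (ENNReal.ofReal m * (1 - daughterLaplace a f x)))) := by
  have hF : Measurable fun z : (κ → ℝ × Prop) × ((κ → ℕ) × (κ × ℕ → ℝ)) =>
      expNeg (∑' p : κ × ℕ,
        if (z.1 p.1).2 ∧ p.2 < z.2.1 p.1 then f ((z.1 p.1).1 + z.2.2 p) else 0) := by
    refine measurable_expNeg.comp (Measurable.tsum fun p => ?_)
    refine Measurable.ite ?_ (hf.comp (by fun_prop)) measurable_const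
    have h1 : Measurable fun z : (κ → ℝ × Prop) × ((κ → ℕ) × (κ × ℕ → ℝ)) => (z.1 p.1).2 :=
      ((measurable_pi_apply p.1).comp measurable_fst).snd
    have h2 : Measurable fun z : (κ → ℝ × Prop) × ((κ → ℕ) × (κ × ℕ → ℝ)) => z.2.1 p.1 :=
      (measurable_pi_apply p.1).comp measurable_snd.fst
    exact (measurableSet_setOfPred.2 h1).inter (measurableSet_lt measurable_const h2)
  have hX : Measurable fun ω i => (M.parents.loc i ω, ω ∈ M.parents.present i) :=
    measurable_pi_lambda _ fun i => (M.parents.measurable_loc i).prodMk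
      (measurableSet_setOfPred.1 (M.parents.measurableSet_present i))
  have hY : Measurable fun ω => ((fun i => M.size i ω), (fun p => M.offset p ω)) :=
    (measurable_pi_lambda _ M.measurable_size).prodMk (measurable_pi_lambda _ M.measurable_offset)
  have hχ : Measurable fun x => ENNReal.ofReal m * (1 - daughterLaplace a f x) :=
    measurable_const.mul (measurable_const.sub (measurable_daughterLaplace ha hf))
  -- The daughters, integrated out given the parents, leave the Poisson functional at `m (1 -
  -- daughterLaplace a f)`.
  rw [← M.parents_poisson.lintegral_expNeg hχ]
  have h1 := lintegral_indepFun M.parents_indep hX hY hF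
  rw [lintegral_congr fun ω => M.lintegral_expNeg_daughters ha hf
    (fun i => M.parents.loc i ω) (fun i => ω ∈ M.parents.present i)] at h1
  simp_rw [M.points.lintegral_config hf, M.parents.lintegral_config hχ]
  simp only [indicator_apply]
  refine Eq.trans (lintegral_congr fun ω => congrArg expNeg (tsum_congr fun p => ?_)) h1
  exact if_congr Iff.rfl rfl rfl

end MaternCluster

/-! ### Weighted means as derivatives of Laplace transforms -/

/-- Halving the step replaces `1 - y²` by `2 (1 - y)`, which is larger since `(1 - y)² ≥ 0`.
Monotone difference quotients allow differentiation under the expectation with no moment assumption.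
-/
theorem two_pow_mul_one_sub_expNeg_monotone (x : ℝ≥0∞) :
    Monotone fun n : ℕ => (2 : ℝ≥0∞) ^ n * (1 - expNeg ((2 ^ n)⁻¹ * x)) := by
  refine monotone_nat_of_le_succ fun n => ?_
  have hx : ((2 : ℝ≥0∞) ^ n)⁻¹ * x = ((2 : ℕ) : ℝ≥0∞) * ((2 ^ (n + 1))⁻¹ * x) := by
    rw [← mul_assoc, pow_succ, ENNReal.mul_inv (by simp) (by simp), mul_comm _ (2 : ℝ≥0∞)⁻¹,
      ← mul_assoc, Nat.cast_ofNat, ENNReal.mul_inv_cancel (by simp) (by simp), one_mul]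
  rw [hx, expNeg_nat_mul]
  set y := expNeg ((2 ^ (n + 1))⁻¹ * x) with hy
  have hy1 : y ≤ 1 := expNeg_le_one _
  obtain ⟨r, hr⟩ : ∃ r : NNReal, y = r := ⟨_, (ENNReal.coe_toNNReal (expNeg_ne_top _)).symm⟩
  have hr1 : r ≤ 1 := by rw [hr] at hy1; exact_mod_cast hy1
  rw [hr, pow_succ (2 : ℝ≥0∞) n, mul_assoc]
  refine mul_le_mul_right ?_ _
  rw [tsub_le_iff_right]
  have : (1 : NNReal) ≤ 2 * (1 - r) + r ^ 2 := by
    rw [← NNReal.coe_le_coe]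
    push_cast [NNReal.coe_sub hr1]
    nlinarith [sq_nonneg (1 - r : ℝ)]
  exact_mod_cast this

theorem tendsto_two_pow_mul_sub {g : ℝ → ℝ} {g' : ℝ} (h : HasDerivAt g g' 0) :
    Tendsto (fun n : ℕ => (2 : ℝ) ^ n * (g 0 - g ((2 ^ n)⁻¹))) atTop (𝓝 (-g')) := by
  have h1 := h.tendsto_slope_zero
  have h2 : Tendsto (fun n : ℕ => ((2 : ℝ) ^ n)⁻¹) atTop (𝓝[≠] 0) := by
    refine tendsto_nhdsWithin_iff.2 ⟨?_, .of_forall fun n => by simp⟩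
    exact tendsto_inv_atTop_zero.comp (tendsto_pow_atTop_atTop_of_one_lt (by norm_num))
  refine ((h1.comp h2).neg).congr fun n => ?_
  simp only [Function.comp, inv_inv, zero_add, smul_eq_mul]
  ring

theorem two_pow_inv_eq_ofReal (n : ℕ) : ((2 : ℝ≥0∞) ^ n)⁻¹ = ENNReal.ofReal ((2 ^ n)⁻¹) := by
  rw [ENNReal.ofReal_inv_of_pos (by positivity), ENNReal.ofReal_pow (by norm_num)]
  simp

theorem tendsto_two_pow_mul_one_sub_expNeg (x : ℝ≥0∞) :
    Tendsto (fun n : ℕ => (2 : ℝ≥0∞) ^ n * (1 - expNeg ((2 ^ n)⁻¹ * x))) atTop (𝓝 x) := by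
  induction x using ENNReal.recTopCoe with
  | top =>
    have : ∀ n : ℕ, ((2 : ℝ≥0∞) ^ n)⁻¹ * ∞ = ∞ := fun n => ENNReal.mul_top (by simp)
    simp only [this, expNeg_top, tsub_zero, mul_one]
    exact ENNReal.tendsto_pow_atTop_nhds_top_iff.2 (by norm_num)
  | coe x =>
    have hd : HasDerivAt (fun t : ℝ => Real.exp (-(t * x))) (-x) 0 := by
      simpa using (((hasDerivAt_id (0 : ℝ)).mul_const (x : ℝ)).neg).exp
    have h1 := ENNReal.tendsto_ofReal (tendsto_two_pow_mul_sub hd)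
    simp only [neg_neg, ENNReal.ofReal_coe_nnreal] at h1
    refine h1.congr fun n => ?_
    have hn : (0 : ℝ) ≤ (2 ^ n)⁻¹ * x := by positivity
    rw [two_pow_inv_eq_ofReal, ← ENNReal.ofReal_coe_nnreal (p := x),
      ← ENNReal.ofReal_mul (by positivity), expNeg_ofReal hn, ENNReal.ofReal_mul (by positivity),
      ENNReal.ofReal_pow (by norm_num), zero_mul, neg_zero, Real.exp_zero,
      ENNReal.ofReal_sub _ (Real.exp_pos _).le]
    simp

/-- The weighted mean of a variable is minus the derivative at `0` of its weighted Laplace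
transform. -/
theorem lintegral_mul_of_hasDerivAt {Ω : Type*} [MeasurableSpace Ω] {P : Measure Ω}
    [IsProbabilityMeasure P] {N W : Ω → ℝ≥0∞} (hN : Measurable N) (hW : Measurable W)
    (hW1 : ∀ ω, W ω ≤ 1) {L : ℝ → ℝ} {d : ℝ}
    (hL : ∀ t, 0 ≤ t → ∫⁻ ω, W ω * expNeg (ENNReal.ofReal t * N ω) ∂P = ENNReal.ofReal (L t))
    (hL0 : ∀ t, 0 ≤ t → 0 ≤ L t) (hd : HasDerivAt L (-d) 0) :
    ∫⁻ ω, N ω * W ω ∂P = ENNReal.ofReal d := by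
  have hm : ∀ n : ℕ, Measurable fun ω => expNeg ((2 ^ n)⁻¹ * N ω) := fun n =>
    measurable_expNeg.comp (measurable_const.mul hN)
  have h1 : Tendsto (fun n : ℕ => ∫⁻ ω, 2 ^ n * (1 - expNeg ((2 ^ n)⁻¹ * N ω)) * W ω ∂P) atTop
      (𝓝 (∫⁻ ω, N ω * W ω ∂P)) := by
    refine lintegral_tendsto_of_tendsto_of_monotone (fun n => ?_) (.of_forall fun ω => ?_)
      (.of_forall fun ω => ?_)
    · exact ((measurable_const.mul (measurable_const.sub (hm n))).mul hW).aemeasurable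
    · intro m n hmn
      exact mul_le_mul_left (two_pow_mul_one_sub_expNeg_monotone (N ω) hmn) (W ω)
    · exact ENNReal.Tendsto.mul_const (tendsto_two_pow_mul_one_sub_expNeg _)
        (.inr (ne_top_of_le_ne_top (by simp) (hW1 ω)))
  have h2 := ENNReal.tendsto_ofReal (tendsto_two_pow_mul_sub hd)
  rw [neg_neg] at h2
  refine tendsto_nhds_unique h1 (h2.congr fun n => ?_)
  have hn : (0 : ℝ) ≤ (2 ^ n)⁻¹ := by positivity
  have hint : ∀ t, 0 ≤ t → ∫⁻ ω, W ω * expNeg (ENNReal.ofReal t * N ω) ∂P ≠ ∞ := fun t ht => by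
    rw [hL t ht]; simp
  have hW0 : ∫⁻ ω, W ω ∂P = ENNReal.ofReal (L 0) := by
    simpa [expNeg_zero] using hL 0 le_rfl
  have hWm : Measurable fun ω => W ω * expNeg ((2 ^ n)⁻¹ * N ω) := hW.mul (hm n)
  -- The difference quotient of `L` with step `2⁻ⁿ` is the integral of the monotone quotients above,
  -- weighted by `W`.
  rw [ENNReal.ofReal_mul (by positivity), ENNReal.ofReal_sub _ (hL0 _ hn), ← hL _ hn, ← hW0,
    ← two_pow_inv_eq_ofReal, ← lintegral_sub hWm
      (by rw [two_pow_inv_eq_ofReal]; exact hint _ hn)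
      (.of_forall fun ω => mul_le_of_le_one_right zero_le (expNeg_le_one _)),
    ENNReal.ofReal_pow (by norm_num), ENNReal.ofReal_ofNat, ← lintegral_const_mul]
  · refine lintegral_congr fun ω => ?_
    rw [mul_assoc, ENNReal.sub_mul (fun _ _ => ne_top_of_le_ne_top (by simp) (hW1 ω)), one_mul,
      mul_comm (W ω)]
  · exact hW.sub hWm

/-! ### Sums over the points in a window, with the point itself removed -/

namespace PointProcess

variable {Ω : Type*} [MeasurableSpace Ω] {ι : Type*}

/-- The points other than the one labelled `i`. -/
noncomputable def othersConfig (Φ : PointProcess Ω ι) (i : ι) (ω : Ω) : Measure ℝ :=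
  Measure.sum fun j : {j : ι // j ≠ i} =>
    (Φ.present j).indicator (fun ω' => Measure.dirac (Φ.loc j ω')) ω

theorem config_eq_dirac_add (Φ : PointProcess Ω ι) {i : ι} {ω : Ω} (h : ω ∈ Φ.present i) :
    Φ.config ω = Measure.dirac (Φ.loc i ω) + Φ.othersConfig i ω := by
  have := Measure.sum_add_sum_compl ({i} : Set ι)
    (fun i => (Φ.present i).indicator (fun ω' => Measure.dirac (Φ.loc i ω')) ω)
  rw [config, ← this]
  congr 1
  have e : (fun k : ({i} : Set ι) =>
      (Φ.present k).indicator (fun ω' => Measure.dirac (Φ.loc k ω')) ω) =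
      fun _ => Measure.dirac (Φ.loc i ω) := by
    funext k
    obtain ⟨k, rfl⟩ := k
    simp [h]
  rw [e]
  ext s hs
  rw [Measure.sum_apply _ hs]
  simp

theorem othersConfig_apply (Φ : PointProcess Ω ι) (i : ι) (ω : Ω) {D : Set ℝ}
    (hD : MeasurableSet D) : Φ.othersConfig i ω D = ∑' j : {j : ι // j ≠ i},
      (Φ.present j).indicator (fun ω' => D.indicator 1 (Φ.loc j ω')) ω := by
  rw [othersConfig, Measure.sum_apply _ hD]
  congr with j
  by_cases h : ω ∈ Φ.present j
  · rw [indicator_of_mem h, indicator_of_mem h, Measure.dirac_apply' _ hD]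
  · rw [indicator_of_notMem h, indicator_of_notMem h, Measure.coe_zero, Pi.zero_apply]

theorem othersSeenFrom_apply (Φ : PointProcess Ω ι) (i : ι) (ω : Ω) {D : Set ℝ}
    (hD : MeasurableSet D) : Φ.othersSeenFrom i ω D = ∑' j : {j : ι // j ≠ i},
      (Φ.present j).indicator (fun ω' => D.indicator 1 (Φ.loc j ω' - Φ.loc i ω')) ω := by
  rw [othersSeenFrom, Measure.sum_apply _ hD]
  congr with j
  by_cases h : ω ∈ Φ.present j
  · rw [indicator_of_mem h, indicator_of_mem h, Measure.dirac_apply' _ hD]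
  · rw [indicator_of_notMem h, indicator_of_notMem h, Measure.coe_zero, Pi.zero_apply]

/-- Undoes the translation, at the price of a ball with a random centre. -/
theorem othersSeenFrom_closedBall (Φ : PointProcess Ω ι) (i : ι) (ω : Ω) (r : ℝ) :
    Φ.othersSeenFrom i ω (Metric.closedBall 0 r) =
      Φ.othersConfig i ω (Metric.closedBall (Φ.loc i ω) r) := by
  rw [Φ.othersSeenFrom_apply i ω measurableSet_closedBall,
    Φ.othersConfig_apply i ω measurableSet_closedBall]
  congr with j
  simp only [indicator, Metric.mem_closedBall, Real.dist_eq, sub_zero, Pi.one_apply]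

theorem measurable_othersConfig_apply [Countable ι] (Φ : PointProcess Ω ι) (i : ι) {D : Set ℝ}
    (hD : MeasurableSet D) : Measurable fun ω => Φ.othersConfig i ω D := by
  simp_rw [Φ.othersConfig_apply i _ hD]
  exact Measurable.tsum fun j =>
    ((measurable_one.indicator hD).comp (Φ.measurable_loc j)).indicator (Φ.measurableSet_present j)

theorem measurable_othersSeenFrom [Countable ι] (Φ : PointProcess Ω ι) (i : ι) :
    Measurable (Φ.othersSeenFrom i) := by
  refine Measure.measurable_of_measurable_coe _ fun D hD => ?_
  simp_rw [Φ.othersSeenFrom_apply i _ hD]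
  exact Measurable.tsum fun j => ((measurable_one.indicator hD).comp
    ((Φ.measurable_loc j).sub (Φ.measurable_loc i))).indicator (Φ.measurableSet_present j)

theorem measurableSet_point (Φ : PointProcess Ω ι) (i : ι) {B : Set ℝ} (hB : MeasurableSet B) :
    MeasurableSet (Φ.present i ∩ Φ.loc i ⁻¹' B) :=
  (Φ.measurableSet_present i).inter (Φ.measurable_loc i hB)

/-- Tonelli over the labels. The weight may depend on the process, which is what Palm averages need.
-/
theorem lintegral_config_mul [Countable ι] (Φ : PointProcess Ω ι) (P : Measure Ω) {B : Set ℝ}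
    (hB : MeasurableSet B) {W : Ω → ℝ≥0∞} (hW : Measurable W) :
    ∫⁻ ω, Φ.config ω B * W ω ∂P = ∑' i, ∫⁻ ω in Φ.present i ∩ Φ.loc i ⁻¹' B, W ω ∂P := by
  simp_rw [Φ.config_apply hB, ← ENNReal.tsum_mul_right]
  have hm : ∀ i, Measurable fun ω =>
      (Φ.present i).indicator (fun ω' => B.indicator (1 : ℝ → ℝ≥0∞) (Φ.loc i ω')) ω * W ω :=
    fun i => (((measurable_one.indicator hB).comp
      (Φ.measurable_loc i)).indicator (Φ.measurableSet_present i)).mul hW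
  rw [lintegral_tsum fun i => (hm i).aemeasurable]
  congr with i
  rw [← lintegral_indicator (Φ.measurableSet_point i hB)]
  congr with ω
  by_cases h1 : ω ∈ Φ.present i <;> by_cases h2 : Φ.loc i ω ∈ B <;> simp [indicator, h1, h2]

/-- The mean over the points in `B` of the Laplace transform, at `T`, of the number of other
points in `D`. -/
noncomputable def palmLaplace (Φ : PointProcess Ω ι) (P : Measure Ω) (T : ℝ≥0∞) (D B : Set ℝ) :
    ℝ≥0∞ :=
  ∑' i, ∫⁻ ω in Φ.present i ∩ Φ.loc i ⁻¹' B, expNeg (T * Φ.othersConfig i ω D) ∂P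

theorem palmLaplace_union (Φ : PointProcess Ω ι) (P : Measure Ω) (T : ℝ≥0∞) (D : Set ℝ)
    {B C : Set ℝ} (hC : MeasurableSet C) (h : Disjoint B C) :
    Φ.palmLaplace P T D (B ∪ C) = Φ.palmLaplace P T D B + Φ.palmLaplace P T D C := by
  rw [palmLaplace, palmLaplace, palmLaplace, ← ENNReal.tsum_add]
  congr with i
  rw [preimage_union, inter_union_distrib_left, lintegral_union (Φ.measurableSet_point i hC)]
  exact (h.preimage _).mono inter_subset_right inter_subset_right

/-- A point of `B` contributes exactly `v` to the count in `D`, so restoring it multiplies every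
term by the same `exp(-T v)`. -/
theorem palmLaplace_of_indicator_eq [Countable ι] (Φ : PointProcess Ω ι) (P : Measure Ω)
    {T : ℝ≥0∞} {D B : Set ℝ} (hD : MeasurableSet D) (hB : MeasurableSet B)
    {v : ℝ≥0∞} (hBD : ∀ x ∈ B, D.indicator 1 x = v) :
    expNeg (T * v) * Φ.palmLaplace P T D B =
      ∫⁻ ω, Φ.config ω B * expNeg (T * Φ.config ω D) ∂P := by
  have hm : Measurable fun ω => expNeg (T * Φ.config ω D) :=
    measurable_expNeg.comp (measurable_const.mul (Φ.measurable_config_apply hD))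
  have hm' : ∀ i, Measurable fun ω => expNeg (T * Φ.othersConfig i ω D) := fun i =>
    measurable_expNeg.comp (measurable_const.mul (Φ.measurable_othersConfig_apply i hD))
  rw [Φ.lintegral_config_mul P hB hm, palmLaplace,
    ← ENNReal.tsum_mul_left]
  congr with i
  rw [← lintegral_const_mul _ (hm' i)]
  refine setLIntegral_congr_fun (Φ.measurableSet_point i hB) fun ω hω => ?_
  rw [Φ.config_eq_dirac_add hω.1, Measure.add_apply, Measure.dirac_apply' _ hD, hBD _ hω.2,
    mul_add, expNeg_add]

/-- If the points in any set `B`, weighted by the Laplace transform of the number of points in `D`,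
have the density `expNeg (T * D.indicator 1 x) * w x`, then `w` is the density that counts
only the other points. -/
theorem palmLaplace_eq_setLIntegral [Countable ι] (Φ : PointProcess Ω ι) (P : Measure Ω)
    {T : ℝ≥0∞} (hT : T ≠ ∞) {D : Set ℝ} (hD : MeasurableSet D) {w : ℝ → ℝ≥0∞} (hw : Measurable w)
    (h : ∀ B, MeasurableSet B → volume B ≠ ∞ →
      ∫⁻ ω, Φ.config ω B * expNeg (T * Φ.config ω D) ∂P =
        ∫⁻ x in B, expNeg (T * D.indicator 1 x) * w x)
    {B : Set ℝ} (hB : MeasurableSet B) (hB' : volume B ≠ ∞) :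
    Φ.palmLaplace P T D B = ∫⁻ x in B, w x := by
  have key : ∀ C, MeasurableSet C → volume C ≠ ∞ → ∀ v : ℝ≥0∞, v ≠ ∞ →
      (∀ x ∈ C, D.indicator 1 x = v) → Φ.palmLaplace P T D C = ∫⁻ x in C, w x := by
    intro C hC hC' v hv hCD
    have h1 := Φ.palmLaplace_of_indicator_eq P (T := T) hD hC hCD
    rw [h C hC hC', setLIntegral_congr_fun hC (g := fun x => expNeg (T * v) * w x)
      (fun x hx => by simp only [hCD x hx]), lintegral_const_mul _ hw] at h1
    -- The factor of the point itself cancels because it is nonzero, `T` being finite.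
    exact (ENNReal.mul_right_inj (expNeg_ne_zero (ENNReal.mul_ne_top hT hv))
      (expNeg_ne_top _)).1 h1
  have hd : Disjoint (B ∩ D) (B \ D) := disjoint_sdiff_inter.symm
  rw [← inter_union_sdiff B D, palmLaplace_union _ _ _ _ (hB.diff hD) hd,
    lintegral_union (hB.diff hD) hd,
    key (B ∩ D) (hB.inter hD) (measure_ne_top_of_subset inter_subset_left hB') 1 (by simp)
      (fun x hx => by simp [hx.2]),
    key (B \ D) (hB.diff hD) (measure_ne_top_of_subset sdiff_subset hB') 0 (by simp)
      (fun x hx => by simp [hx.2])]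

end PointProcess

/-! ### The test functions `t 1_D + τ 1_B` -/

/-- The function with value `1 - exp (-t)` on `D` and `0` elsewhere. -/
noncomputable def thinning (t : ℝ) (D : Set ℝ) : ℝ → ℝ := D.indicator fun _ => 1 - Real.exp (-t)

theorem thinning_nonneg {t : ℝ} (ht : 0 ≤ t) (D : Set ℝ) (x : ℝ) : 0 ≤ thinning t D x :=
  indicator_nonneg (fun _ _ => by simpa using ht) x

theorem thinning_le_one (t : ℝ) (D : Set ℝ) (x : ℝ) : thinning t D x ≤ 1 :=
  indicator_le' (fun _ _ => by simpa using (Real.exp_pos (-t)).le) (fun _ _ => zero_le_one) x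

theorem measurable_thinning (t : ℝ) {D : Set ℝ} (hD : MeasurableSet D) :
    Measurable (thinning t D) := measurable_const.indicator hD

theorem integrable_thinning (t : ℝ) {D : Set ℝ} (hD : MeasurableSet D) (hD' : volume D ≠ ∞) :
    Integrable (thinning t D) := by
  rw [thinning, integrable_indicator_iff hD]
  exact integrableOn_const hD'

/-- The part of the points in `B` that survives the thinning in `D`. -/
noncomputable def unthinned (t : ℝ) (D B : Set ℝ) : ℝ → ℝ :=
  B.indicator fun x => 1 - thinning t D x

theorem unthinned_nonneg (t : ℝ) (D B : Set ℝ) (x : ℝ) : 0 ≤ unthinned t D B x :=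
  indicator_nonneg (fun x _ => sub_nonneg.2 (thinning_le_one t D x)) x

theorem unthinned_le_one {t : ℝ} (ht : 0 ≤ t) (D B : Set ℝ) (x : ℝ) : unthinned t D B x ≤ 1 :=
  indicator_le' (fun x _ => sub_le_self _ (thinning_nonneg ht D x)) (fun _ _ => zero_le_one) x

theorem measurable_unthinned (t : ℝ) {D B : Set ℝ} (hD : MeasurableSet D) (hB : MeasurableSet B) :
    Measurable (unthinned t D B) := (measurable_const.sub (measurable_thinning t hD)).indicator hB

theorem integrable_unthinned (t : ℝ) {D B : Set ℝ} (hD : MeasurableSet D) (hD' : volume D ≠ ∞)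
    (hB : MeasurableSet B) (hB' : volume B ≠ ∞) : Integrable (unthinned t D B) := by
  rw [unthinned, integrable_indicator_iff hB]
  exact (integrableOn_const hB').sub (integrable_thinning t hD hD').integrableOn

theorem expNeg_mul_indicator {t : ℝ} (ht : 0 ≤ t) (D : Set ℝ) (x : ℝ) :
    expNeg (ENNReal.ofReal t * D.indicator 1 x) = ENNReal.ofReal (1 - thinning t D x) := by
  by_cases h : x ∈ D <;> simp [thinning, h, expNeg_ofReal ht, expNeg_zero]

/-- On `B` this is `1 - (1 - φ) e^{-τ} = φ + (1 - e^{-τ}) (1 - φ)`, with `φ` the thinning. The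
result is affine in `1 - e^{-τ}`, the variable in which derivatives are taken below. -/
theorem expNeg_mul_indicator_add {t τ : ℝ} (ht : 0 ≤ t) (hτ : 0 ≤ τ) (D B : Set ℝ) (x : ℝ) :
    1 - expNeg (ENNReal.ofReal t * D.indicator 1 x + ENNReal.ofReal τ * B.indicator 1 x) =
      ENNReal.ofReal (thinning t D x + (1 - Real.exp (-τ)) * unthinned t D B x) := by
  have h1 : ∀ s, 1 - thinning s B x ≥ 0 := fun s => sub_nonneg.2 (thinning_le_one _ _ _)
  rw [expNeg_add, expNeg_mul_indicator ht, expNeg_mul_indicator hτ, ← ENNReal.ofReal_mul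
    (sub_nonneg.2 (thinning_le_one _ _ _)), ← ENNReal.ofReal_one, ← ENNReal.ofReal_sub _
    (mul_nonneg (sub_nonneg.2 (thinning_le_one _ _ _)) (h1 _))]
  congr 1
  by_cases h : x ∈ B
  · simp only [thinning, unthinned, h, indicator_of_mem]
    ring
  · simp [thinning, unthinned, h]

theorem measurable_mul_indicator (c : ℝ≥0∞) {D : Set ℝ} (hD : MeasurableSet D) :
    Measurable fun x => c * D.indicator (1 : ℝ → ℝ≥0∞) x :=
  measurable_const.mul (measurable_one.indicator hD)

theorem setLIntegral_ofReal_one_sub_thinning {t : ℝ} (D : Set ℝ) {B : Set ℝ}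
    (hB : MeasurableSet B) (w : ℝ → ℝ≥0∞) :
    ∫⁻ x in B, ENNReal.ofReal (1 - thinning t D x) * w x =
      ∫⁻ x, ENNReal.ofReal (unthinned t D B x) * w x := by
  rw [← lintegral_indicator hB]
  congr with x
  by_cases h : x ∈ B <;> simp [unthinned, h]

/-! ### Palm sums of a Poisson process -/

namespace PointProcess

variable {Ω : Type*} [MeasurableSpace Ω] {ι : Type*} [Countable ι] {P : Measure Ω}
  [IsProbabilityMeasure P] {Φ : PointProcess Ω ι} {lam : ℝ}

/-- Points in `B`, weighted by the Laplace transform of the number of points in `D`, obtained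
from the Laplace functional. -/
theorem lintegral_count_mul_of_hasDerivAt (Φ : PointProcess Ω ι) (P : Measure Ω)
    [IsProbabilityMeasure P] (t : ℝ) {D B : Set ℝ} (hD : MeasurableSet D)
    (hB : MeasurableSet B) {G : ℝ → ℝ} {g' : ℝ} (hG : HasDerivAt G g' 0)
    (hL : ∀ τ, 0 ≤ τ → ∫⁻ ω, expNeg (∫⁻ x, (ENNReal.ofReal t * D.indicator 1 x +
      ENNReal.ofReal τ * B.indicator 1 x) ∂(Φ.config ω)) ∂P =
        ENNReal.ofReal (Real.exp (-G (1 - Real.exp (-τ))))) :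
    ∫⁻ ω, Φ.config ω B * expNeg (ENNReal.ofReal t * Φ.config ω D) ∂P =
      ENNReal.ofReal (g' * Real.exp (-G 0)) := by
  have e : ∀ τ ω, ∫⁻ x, (ENNReal.ofReal t * D.indicator 1 x +
      ENNReal.ofReal τ * B.indicator 1 x) ∂(Φ.config ω) =
      ENNReal.ofReal t * Φ.config ω D + ENNReal.ofReal τ * Φ.config ω B := by
    intro τ ω
    rw [lintegral_add_left (measurable_mul_indicator _ hD),
      lintegral_const_mul _ (measurable_one.indicator hD),
      lintegral_const_mul _ (measurable_one.indicator hB), lintegral_indicator_one hD,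
      lintegral_indicator_one hB]
  simp_rw [e, expNeg_add] at hL
  refine lintegral_mul_of_hasDerivAt (Φ.measurable_config_apply hB)
    (measurable_expNeg.comp (measurable_const.mul (Φ.measurable_config_apply hD)))
    (fun ω => expNeg_le_one _) hL (fun τ _ => (Real.exp_pos _).le) ?_
  -- The change of variable has slope `1` at `0`, so it does not affect the derivative.
  have h1 : HasDerivAt (fun τ : ℝ => 1 - Real.exp (-τ)) 1 0 := by
    simpa using ((hasDerivAt_id (0 : ℝ)).neg.exp).const_sub 1
  have h2 : HasDerivAt (fun τ : ℝ => G (1 - Real.exp (-τ))) (g' * 1) 0 :=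
    HasDerivAt.comp (0 : ℝ) (h₂ := G)
      (h := fun τ : ℝ => 1 - Real.exp (-τ)) (by simpa using hG) h1
  have h3 := h2.fun_neg.exp
  simp only [neg_zero, Real.exp_zero, sub_self] at h3
  convert h3 using 1
  ring

/-- The exponent is affine with slope `λ ∫_B (1 - φ)`, `φ` being the thinning. Once the factor `1 -
φ` of the point itself is removed, the density is constant: the other points have the transform of
the whole process (Slivnyak). -/
theorem IsPoisson.palmLaplace_eq (h : Φ.IsPoisson P lam) (hlam : 0 < lam) {t : ℝ} (ht : 0 ≤ t)
    {D B : Set ℝ} (hD : MeasurableSet D) (hD' : volume D ≠ ∞) (hB : MeasurableSet B)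
    (hB' : volume B ≠ ∞) :
    Φ.palmLaplace P (ENNReal.ofReal t) D B = volume B *
      ENNReal.ofReal (lam * Real.exp (-(lam * ((1 - Real.exp (-t)) * volume.real D)))) := by
  have hI : ∫ x, thinning t D x = (1 - Real.exp (-t)) * volume.real D := by
    rw [thinning, integral_indicator hD]
    simp [mul_comm]
  rw [← hI, mul_comm, ← setLIntegral_const]
  refine Φ.palmLaplace_eq_setLIntegral P ENNReal.ofReal_ne_top hD measurable_const ?_ hB hB'
  intro B hB hB'
  have hφ := integrable_thinning t hD hD'
  have hψ := integrable_unthinned t hD hD' hB hB'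
  simp_rw [expNeg_mul_indicator ht]
  rw [setLIntegral_ofReal_one_sub_thinning D hB,
    lintegral_mul_const _ (measurable_unthinned t hD hB).ennreal_ofReal,
    ← ofReal_integral_eq_lintegral_ofReal hψ (.of_forall (unthinned_nonneg t D B)),
    ← ENNReal.ofReal_mul (integral_nonneg (unthinned_nonneg t D B))]
  have hG : HasDerivAt (fun τ => lam * ((∫ x, thinning t D x) + τ * ∫ x, unthinned t D B x))
      (lam * ∫ x, unthinned t D B x) 0 := by
    simpa using (((hasDerivAt_id (0 : ℝ)).mul_const (∫ x, unthinned t D B x)).const_add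
      (∫ x, thinning t D x)).const_mul lam
  rw [Φ.lintegral_count_mul_of_hasDerivAt P t hD hB hG]
  · congr 1
    simp only [zero_mul, add_zero]
    ring
  · intro τ hτ
    have hτ' : 0 ≤ 1 - Real.exp (-τ) := by simpa using hτ
    rw [h.lintegral_expNeg (f := fun x => ENNReal.ofReal t * D.indicator 1 x +
      ENNReal.ofReal τ * B.indicator 1 x)
      ((measurable_mul_indicator _ hD).add (measurable_mul_indicator _ hB))]
    simp_rw [expNeg_mul_indicator_add ht hτ]
    have hs : Integrable fun x => thinning t D x + (1 - Real.exp (-τ)) * unthinned t D B x :=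
      hφ.add (hψ.const_mul _)
    rw [← ofReal_integral_eq_lintegral_ofReal hs
      (.of_forall fun x => add_nonneg (thinning_nonneg ht D x)
        (mul_nonneg hτ' (unthinned_nonneg t D B x))),
      ← ENNReal.ofReal_mul hlam.le, expNeg_ofReal, integral_add hφ (hψ.const_mul _),
      integral_const_mul]
    exact mul_nonneg hlam.le (integral_nonneg fun x => add_nonneg (thinning_nonneg ht D x)
        (mul_nonneg hτ' (unthinned_nonneg t D B x)))

end PointProcess

/-! ### Averages over the offset of a daughter -/

/-- The mean of `φ` at a point uniform in `[x - a, x + a]`. -/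
noncomputable def offsetMean (a : ℝ) (φ : ℝ → ℝ) (x : ℝ) : ℝ :=
  ∫ u, φ (x + u) ∂(cond volume (Metric.closedBall (0 : ℝ) a))

section OffsetMean

variable {a : ℝ} {φ ψ : ℝ → ℝ}

theorem integrable_comp_add_cond (ha : 0 < a) (hφ : Measurable φ) (h0 : ∀ x, 0 ≤ φ x)
    (h1 : ∀ x, φ x ≤ 1) (x : ℝ) :
    Integrable (fun u => φ (x + u)) (cond volume (Metric.closedBall (0 : ℝ) a)) := by
  have := MaternCluster.isProbabilityMeasure_cond_closedBall ha
  refine Integrable.of_bound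
    (hφ.comp (measurable_const.add measurable_id)).aestronglyMeasurable 1 (.of_forall fun u => ?_)
  rw [Real.norm_eq_abs, abs_of_nonneg (h0 _)]
  exact h1 _

theorem offsetMean_nonneg (h0 : ∀ x, 0 ≤ φ x) (x : ℝ) : 0 ≤ offsetMean a φ x :=
  integral_nonneg fun _ => h0 _

theorem offsetMean_le_one (ha : 0 < a) (hφ : Measurable φ) (h0 : ∀ x, 0 ≤ φ x)
    (h1 : ∀ x, φ x ≤ 1) (x : ℝ) : offsetMean a φ x ≤ 1 := by
  have := MaternCluster.isProbabilityMeasure_cond_closedBall ha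
  calc offsetMean a φ x ≤ ∫ _, 1 ∂(cond volume (Metric.closedBall (0 : ℝ) a)) :=
        integral_mono (integrable_comp_add_cond ha hφ h0 h1 x) (integrable_const _) fun _ => h1 _
    _ = 1 := by simp

theorem offsetMean_mono (ha : 0 < a) (hφ : Measurable φ) (h0 : ∀ x, 0 ≤ φ x)
    (hψ : Measurable ψ) (h1 : ∀ x, ψ x ≤ 1) (h : ∀ x, φ x ≤ ψ x) (x : ℝ) :
    offsetMean a φ x ≤ offsetMean a ψ x :=
  integral_mono (integrable_comp_add_cond ha hφ h0 (fun x => (h x).trans (h1 x)) x)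
    (integrable_comp_add_cond ha hψ (fun x => (h0 x).trans (h x)) h1 x) fun _ => h _

theorem measurable_offsetMean (ha : 0 < a) (hφ : Measurable φ) : Measurable (offsetMean a φ) := by
  have := MaternCluster.isProbabilityMeasure_cond_closedBall ha
  have : StronglyMeasurable fun p : ℝ × ℝ => φ (p.1 + p.2) :=
    (hφ.comp (measurable_fst.add measurable_snd)).stronglyMeasurable
  exact this.integral_prod_right'.measurable

theorem ofReal_offsetMean (ha : 0 < a) (hφ : Measurable φ) (h0 : ∀ x, 0 ≤ φ x)
    (h1 : ∀ x, φ x ≤ 1) (x : ℝ) : ENNReal.ofReal (offsetMean a φ x) =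
      ∫⁻ u, ENNReal.ofReal (φ (x + u)) ∂(cond volume (Metric.closedBall (0 : ℝ) a)) :=
  ofReal_integral_eq_lintegral_ofReal (integrable_comp_add_cond ha hφ h0 h1 x)
    (.of_forall fun _ => h0 _)

/-- Exchange of the position of a parent with that of its daughter. -/
theorem lintegral_ofReal_offsetMean_mul (ha : 0 < a) (hφ : Measurable φ) (h0 : ∀ x, 0 ≤ φ x)
    (h1 : ∀ x, φ x ≤ 1) {h : ℝ → ℝ≥0∞} (hh : Measurable h) :
    ∫⁻ x, ENNReal.ofReal (offsetMean a φ x) * h x =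
      ∫⁻ z, ENNReal.ofReal (φ z) *
        ∫⁻ u, h (z - u) ∂(cond volume (Metric.closedBall (0 : ℝ) a)) := by
  have := MaternCluster.isProbabilityMeasure_cond_closedBall ha
  have m1 : Measurable fun p : ℝ × ℝ => ENNReal.ofReal (φ (p.1 + p.2)) * h p.1 :=
    (hφ.comp (measurable_fst.add measurable_snd)).ennreal_ofReal.mul (hh.comp measurable_fst)
  have m2 : Measurable fun p : ℝ × ℝ => ENNReal.ofReal (φ p.1) * h (p.1 - p.2) :=
    (hφ.comp measurable_fst).ennreal_ofReal.mul (hh.comp (measurable_fst.sub measurable_snd))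
  calc ∫⁻ x, ENNReal.ofReal (offsetMean a φ x) * h x
      = ∫⁻ x, ∫⁻ u, ENNReal.ofReal (φ (x + u)) * h x
          ∂(cond volume (Metric.closedBall (0 : ℝ) a)) := by
        refine lintegral_congr fun x => ?_
        rw [ofReal_offsetMean ha hφ h0 h1, lintegral_mul_const]
        exact (hφ.comp (measurable_const.add measurable_id)).ennreal_ofReal
    _ = ∫⁻ u, (∫⁻ x, ENNReal.ofReal (φ (x + u)) * h x)
          ∂(cond volume (Metric.closedBall (0 : ℝ) a)) :=
        lintegral_lintegral_swap m1.aemeasurable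
    _ = ∫⁻ u, (∫⁻ z, ENNReal.ofReal (φ z) * h (z - u))
          ∂(cond volume (Metric.closedBall (0 : ℝ) a)) := by
        refine lintegral_congr fun u => ?_
        -- Translation by `u` is the substitution `z = x + u`, from parent to daughter.
        rw [← lintegral_add_right_eq_self (fun z => ENNReal.ofReal (φ z) * h (z - u)) u]
        simp
    _ = ∫⁻ z, ∫⁻ u, ENNReal.ofReal (φ z) * h (z - u)
          ∂(cond volume (Metric.closedBall (0 : ℝ) a)) :=
        (lintegral_lintegral_swap m2.aemeasurable).symm
    _ = _ := by
        refine lintegral_congr fun z => ?_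
        exact lintegral_const_mul _ (hh.comp (measurable_const.sub measurable_id))

theorem integrable_offsetMean (ha : 0 < a) (hφ : Measurable φ) (h0 : ∀ x, 0 ≤ φ x)
    (h1 : ∀ x, φ x ≤ 1) (hi : Integrable φ) : Integrable (offsetMean a φ) := by
  have := MaternCluster.isProbabilityMeasure_cond_closedBall ha
  refine ⟨(measurable_offsetMean ha hφ).aestronglyMeasurable, ?_⟩
  rw [hasFiniteIntegral_iff_ofReal (.of_forall (offsetMean_nonneg h0))]
  have := lintegral_ofReal_offsetMean_mul ha hφ h0 h1 (h := fun _ => 1) measurable_const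
  simp only [mul_one, lintegral_const, measure_univ] at this
  rw [this]
  exact (hasFiniteIntegral_iff_ofReal (.of_forall h0)).1 hi.2

theorem integrable_one_sub_exp {m : ℝ} (hm : 0 ≤ m) {q : ℝ → ℝ} (hq : Integrable q)
    (hq0 : ∀ x, 0 ≤ q x) : Integrable fun x => 1 - Real.exp (-(m * q x)) := by
  refine Integrable.mono' (hq.const_mul m) ?_ (.of_forall fun x => ?_)
  · exact aestronglyMeasurable_const.sub
      (Real.continuous_exp.comp_aestronglyMeasurable (hq.1.const_mul m).neg)
  · have : 0 ≤ m * q x := mul_nonneg hm (hq0 x)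
    rw [Real.norm_eq_abs, abs_of_nonneg (by simpa using this)]
    linarith [Real.add_one_le_exp (-(m * q x))]

/-- Differentiation of the exponent of the Laplace functional of a cluster process. -/
theorem hasDerivAt_integral_one_sub_exp {m : ℝ} (hm : 0 ≤ m) {q k : ℝ → ℝ} (hq : Integrable q)
    (hq0 : ∀ x, 0 ≤ q x) (hk : Integrable k) (hk0 : ∀ x, 0 ≤ k x) (hk1 : ∀ x, k x ≤ 1) :
    Integrable (fun x => m * k x * Real.exp (-(m * q x))) ∧
    HasDerivAt (fun τ : ℝ => ∫ x, (1 - Real.exp (-(m * (q x + τ * k x)))))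
      (∫ x, m * k x * Real.exp (-(m * q x))) 0 := by
  have hm' : ∀ τ : ℝ, AEStronglyMeasurable (fun x => Real.exp (-(m * (q x + τ * k x)))) :=
    fun τ => Real.continuous_exp.comp_aestronglyMeasurable
      ((hq.1.add (hk.1.const_mul τ)).const_mul m).neg
  have := hasDerivAt_integral_of_dominated_loc_of_deriv_le (μ := volume) (x₀ := (0 : ℝ))
    (F := fun τ x => 1 - Real.exp (-(m * (q x + τ * k x))))
    (F' := fun τ x => m * k x * Real.exp (-(m * (q x + τ * k x))))
    -- For `|τ| < 1`, `q ≥ 0` and `0 ≤ k ≤ 1` give `q + τ k ≥ -1`, so the exponential is at most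
    -- `e^m`.
    (bound := fun x => m * Real.exp m * k x) (Metric.ball_mem_nhds (0 : ℝ) one_pos)
    (.of_forall fun τ => aestronglyMeasurable_const.sub (hm' τ))
    (by simpa using integrable_one_sub_exp hm hq hq0)
    ((hk.1.const_mul m).mul (hm' 0))
    (.of_forall fun x τ hτ => ?_) (hk.const_mul _) (.of_forall fun x τ _ => ?_)
  · simpa using this
  · rw [Metric.mem_ball, Real.dist_eq, sub_zero, abs_lt] at hτ
    rw [Real.norm_eq_abs, abs_of_nonneg (mul_nonneg (mul_nonneg hm (hk0 x)) (Real.exp_pos _).le)]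
    have h1 : -(m * (q x + τ * k x)) ≤ m := by
      have : -1 ≤ q x + τ * k x := by nlinarith [hq0 x, hk0 x, hk1 x]
      nlinarith
    calc m * k x * Real.exp (-(m * (q x + τ * k x))) ≤ m * k x * Real.exp m :=
          mul_le_mul_of_nonneg_left (Real.exp_le_exp.2 h1) (mul_nonneg hm (hk0 x))
      _ = _ := by ring
  · have h1 : HasDerivAt (fun τ : ℝ => -(m * (q x + τ * k x))) (-(m * k x)) τ := by
      simpa using ((((hasDerivAt_id τ).mul_const (k x)).const_add (q x)).const_mul m).fun_neg
    convert (h1.exp).const_sub 1 using 1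
    ring

end OffsetMean

/-! ### Palm sums of a Matérn cluster process -/

namespace MaternCluster

variable {Ω : Type*} [MeasurableSpace Ω] {P : Measure Ω} [IsProbabilityMeasure P] {κ : Type*}
  [Countable κ] {lamP m a : ℝ}

theorem lintegral_expNeg_points_eq_exp (M : MaternCluster P κ lamP m a) (hl : 0 < lamP)
    (hm : 0 < m) (ha : 0 < a) {f : ℝ → ℝ≥0∞} (hf : Measurable f) {φ : ℝ → ℝ}
    (hφ : Measurable φ) (h0 : ∀ x, 0 ≤ φ x) (h1 : ∀ x, φ x ≤ 1) (hi : Integrable φ)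
    (h : ∀ x, 1 - expNeg (f x) = ENNReal.ofReal (φ x)) :
    ∫⁻ ω, expNeg (∫⁻ x, f x ∂(M.points.config ω)) ∂P = ENNReal.ofReal
      (Real.exp (-(lamP * ∫ x, (1 - Real.exp (-(m * offsetMean a φ x)))))) := by
  have := isProbabilityMeasure_cond_closedBall ha
  have e1 : ∀ x, 1 - daughterLaplace a f x = ENNReal.ofReal (offsetMean a φ x) := by
    intro x
    have hfx : Measurable fun u => expNeg (f (x + u)) :=
      measurable_expNeg.comp (hf.comp (measurable_const.add measurable_id))
    rw [ofReal_offsetMean ha hφ h0 h1]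
    simp_rw [← h]
    rw [lintegral_sub hfx (ne_top_of_le_ne_top (by simp) (daughterLaplace_le_one ha f x))
      (.of_forall fun u => expNeg_le_one _)]
    simp [daughterLaplace]
  have hq := integrable_offsetMean ha hφ h0 h1 hi
  have hnn : ∀ x, 0 ≤ m * offsetMean a φ x := fun x => mul_nonneg hm.le (offsetMean_nonneg h0 x)
  have e2 : ∀ x, 1 - expNeg (ENNReal.ofReal m * (1 - daughterLaplace a f x)) =
      ENNReal.ofReal (1 - Real.exp (-(m * offsetMean a φ x))) := by
    intro x
    rw [e1, ← ENNReal.ofReal_mul hm.le, expNeg_ofReal (hnn x),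
      ENNReal.ofReal_sub _ (Real.exp_pos _).le, ENNReal.ofReal_one]
  have hnn' : ∀ x, 0 ≤ 1 - Real.exp (-(m * offsetMean a φ x)) := fun x => by simpa using hnn x
  rw [M.lintegral_expNeg_points ha hf]
  simp_rw [e2]
  rw [← ofReal_integral_eq_lintegral_ofReal
    (integrable_one_sub_exp hm.le hq (offsetMean_nonneg h0)) (.of_forall hnn'),
    ← ENNReal.ofReal_mul hl.le, expNeg_ofReal (mul_nonneg hl.le (integral_nonneg hnn'))]

/-- Differentiating the exponent yields an integral over parents `x` of the mean of `unthinned`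
around `x`, weighted by the transform of a whole cluster at `x`. Exchanging parent and daughter
turns it into an integral over the typical daughter `z`, with its parent at `z - u` for a uniform
`u`. The siblings form a full Poisson cluster again, whence the additional factor. -/
theorem palmLaplace_eq (M : MaternCluster P κ lamP m a) (hl : 0 < lamP)
    (hm : 0 < m) (ha : 0 < a) {t : ℝ} (ht : 0 ≤ t) {D B : Set ℝ} (hD : MeasurableSet D)
    (hD' : volume D ≠ ∞) (hB : MeasurableSet B) (hB' : volume B ≠ ∞) :
    M.points.palmLaplace P (ENNReal.ofReal t) D B = ENNReal.ofReal (lamP * m * Real.exp (-(lamP *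
        ∫ x, (1 - Real.exp (-(m * offsetMean a (thinning t D) x)))))) *
      ∫⁻ z in B, ∫⁻ u, ENNReal.ofReal (Real.exp (-(m * offsetMean a (thinning t D) (z - u))))
        ∂(cond volume (Metric.closedBall (0 : ℝ) a)) := by
  have := isProbabilityMeasure_cond_closedBall ha
  have mφ := measurable_thinning t hD
  have hφ := integrable_thinning t hD hD'
  have φ0 := thinning_nonneg ht D
  have φ1 := thinning_le_one t D
  have mh : Measurable fun x =>
      ENNReal.ofReal (Real.exp (-(m * offsetMean a (thinning t D) x))) :=
    (Real.measurable_exp.comp (measurable_const.mul (measurable_offsetMean ha mφ)).neg).ennreal_ofReal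
  have mw : Measurable fun z : ℝ =>
      ∫⁻ u, ENNReal.ofReal (Real.exp (-(m * offsetMean a (thinning t D) (z - u))))
        ∂(cond volume (Metric.closedBall (0 : ℝ) a)) :=
    Measurable.lintegral_prod_right' (f := fun p : ℝ × ℝ =>
      ENNReal.ofReal (Real.exp (-(m * offsetMean a (thinning t D) (p.1 - p.2)))))
      (mh.comp (measurable_fst.sub measurable_snd))
  rw [← lintegral_const_mul _ mw]
  refine M.points.palmLaplace_eq_setLIntegral P ENNReal.ofReal_ne_top hD
    (measurable_const.mul mw) ?_ hB hB'
  intro B hB hB'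
  have mψ := measurable_unthinned t hD hB
  have hψ := integrable_unthinned t hD hD' hB hB'
  have ψ0 := unthinned_nonneg t D B
  have ψ1 := unthinned_le_one ht D B
  have iφ := integrable_offsetMean ha mφ φ0 φ1 hφ
  have iψ := integrable_offsetMean ha mψ ψ0 ψ1 hψ
  obtain ⟨iG, hG⟩ := hasDerivAt_integral_one_sub_exp hm.le iφ (offsetMean_nonneg φ0) iψ
    (offsetMean_nonneg ψ0) (offsetMean_le_one ha mψ ψ0 ψ1)
  simp_rw [expNeg_mul_indicator ht]
  rw [setLIntegral_ofReal_one_sub_thinning D hB]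
  simp only [Pi.mul_apply]
  rw [lintegral_congr fun x => mul_left_comm (ENNReal.ofReal (unthinned t D B x)) _ _]
  rw [lintegral_const_mul' _ _ ENNReal.ofReal_ne_top,
    -- The averaging moves from the cluster factor to the test function, the form in which the
    -- derivative appears.
    ← lintegral_ofReal_offsetMean_mul ha mψ ψ0 ψ1 mh,
    M.points.lintegral_count_mul_of_hasDerivAt P t hD hB (hG.const_mul lamP)]
  · simp_rw [← ENNReal.ofReal_mul (offsetMean_nonneg ψ0 _)]
    have e : ∀ x, offsetMean a (unthinned t D B) x *
        Real.exp (-(m * offsetMean a (thinning t D) x)) = m⁻¹ * (m * offsetMean a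
          (unthinned t D B) x * Real.exp (-(m * offsetMean a (thinning t D) x))) := by
      intro x
      field_simp
    simp_rw [e]
    rw [← ofReal_integral_eq_lintegral_ofReal (iG.const_mul _) (.of_forall fun x =>
      mul_nonneg (inv_nonneg.2 hm.le) (mul_nonneg (mul_nonneg hm.le (offsetMean_nonneg ψ0 x))
        (Real.exp_pos _).le)), integral_const_mul, ← ENNReal.ofReal_mul (by positivity)]
    congr 1
    simp only [zero_mul, add_zero]
    field_simp
  · intro τ hτ
    have hτ' : 0 ≤ 1 - Real.exp (-τ) := by simpa using hτ
    have e : ∀ x, offsetMean a (fun x => thinning t D x + (1 - Real.exp (-τ)) *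
        unthinned t D B x) x = offsetMean a (thinning t D) x + (1 - Real.exp (-τ)) *
          offsetMean a (unthinned t D B) x := by
      intro x
      rw [offsetMean, integral_add (integrable_comp_add_cond ha mφ φ0 φ1 x)
        ((integrable_comp_add_cond ha mψ ψ0 ψ1 x).const_mul _), integral_const_mul]
      rfl
    simp_rw [← e]
    refine M.lintegral_expNeg_points_eq_exp hl hm ha
      ((measurable_mul_indicator _ hD).add (measurable_mul_indicator _ hB))
      (mφ.add (measurable_const.mul mψ))
      (fun x => add_nonneg (φ0 x) (mul_nonneg hτ' (ψ0 x))) (fun x => ?_)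
      (hφ.add (hψ.const_mul _)) (expNeg_mul_indicator_add ht hτ D B)
    -- Keeps the combined test function at most `1`.
    have h1 : (1 - Real.exp (-τ)) * unthinned t D B x ≤ 1 * (1 - thinning t D x) := by
      refine mul_le_mul (by simpa using (Real.exp_pos (-τ)).le) ?_ (ψ0 x) zero_le_one
      exact indicator_le_self' (fun x _ => sub_nonneg.2 (φ1 x)) x
    linarith

end MaternCluster

/-! ### From fixed sets to balls centred at the typical point -/

namespace PointProcess

variable {Ω : Type*} [MeasurableSpace Ω] {ι : Type*}

/-- The mean over the points in `B` of the Laplace transform, at `T`, of the number of other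
points at distance at most `r`. -/
noncomputable def neighbourLaplace (Φ : PointProcess Ω ι) (P : Measure Ω) (T : ℝ≥0∞) (r : ℝ)
    (B : Set ℝ) : ℝ≥0∞ :=
  ∑' i, ∫⁻ ω in Φ.present i ∩ Φ.loc i ⁻¹' B,
    expNeg (T * Φ.othersConfig i ω (Metric.closedBall (Φ.loc i ω) r)) ∂P

theorem neighbourLaplace_iUnion (Φ : PointProcess Ω ι) (P : Measure Ω) (T : ℝ≥0∞) (r : ℝ)
    {B : ℤ → Set ℝ} (hB : ∀ k, MeasurableSet (B k)) (hd : Pairwise (Function.onFun Disjoint B)) :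
    Φ.neighbourLaplace P T r (⋃ k, B k) = ∑' k, Φ.neighbourLaplace P T r (B k) := by
  simp only [neighbourLaplace]
  rw [ENNReal.tsum_comm]
  congr with i
  rw [preimage_iUnion, inter_iUnion, lintegral_iUnion fun k => Φ.measurableSet_point i (hB k)]
  intro j k hjk
  exact ((hd hjk).preimage _).mono inter_subset_right inter_subset_right

/-- A ball of radius `r` about a point of `B` lies in the fixed ball of radius `r + ε`, and `expNeg`
is antitone. -/
theorem palmLaplace_le_neighbourLaplace (Φ : PointProcess Ω ι) (P : Measure Ω) (T : ℝ≥0∞)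
    {r ε y : ℝ} {B : Set ℝ} (hB : MeasurableSet B) (h : B ⊆ Metric.closedBall y ε) :
    Φ.palmLaplace P T (Metric.closedBall y (r + ε)) B ≤ Φ.neighbourLaplace P T r B := by
  refine ENNReal.tsum_le_tsum fun i => setLIntegral_mono' (Φ.measurableSet_point i hB)
    fun ω hω => expNeg_antitone (mul_le_mul_right (measure_mono ?_) _)
  refine Metric.closedBall_subset_closedBall' ?_
  have := h hω.2
  rw [Metric.mem_closedBall] at this
  linarith

theorem neighbourLaplace_le_palmLaplace (Φ : PointProcess Ω ι) (P : Measure Ω) (T : ℝ≥0∞)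
    {r ε y : ℝ} {B : Set ℝ} (hB : MeasurableSet B) (h : B ⊆ Metric.closedBall y ε) :
    Φ.neighbourLaplace P T r B ≤ Φ.palmLaplace P T (Metric.closedBall y (r - ε)) B := by
  refine ENNReal.tsum_le_tsum fun i => setLIntegral_mono' (Φ.measurableSet_point i hB)
    fun ω hω => expNeg_antitone (mul_le_mul_right (measure_mono ?_) _)
  refine Metric.closedBall_subset_closedBall' ?_
  have := h hω.2
  rw [Metric.mem_closedBall, dist_comm] at this
  linarith

/-- The transform of the number of neighbours, from bounds for points in small windows. -/
theorem neighbourLaplace_eq (Φ : PointProcess Ω ι) (P : Measure Ω) (T : ℝ≥0∞) {r : ℝ}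
    {V : ℝ → ℝ≥0∞} (hV : ContinuousAt V r)
    (hlow : ∀ (y ρ ε : ℝ) (B : Set ℝ), MeasurableSet B → B ⊆ Metric.closedBall y ε →
      volume B * V (ρ + ε) ≤ Φ.palmLaplace P T (Metric.closedBall y ρ) B)
    (hupp : ∀ (y ρ ε : ℝ) (B : Set ℝ), MeasurableSet B → B ⊆ Metric.closedBall y ε →
      Φ.palmLaplace P T (Metric.closedBall y ρ) B ≤ volume B * V (ρ - ε))
    {B : Set ℝ} (hB : MeasurableSet B) (hB' : volume B ≠ ∞) :
    Φ.neighbourLaplace P T r B = volume B * V r := by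
  -- One `ε` pays for fixing the centre of the ball, the other is the allowance in `hlow` and
  -- `hupp`.
  have key : ∀ ε : ℝ, 0 < ε → volume B * V (r + 2 * ε) ≤ Φ.neighbourLaplace P T r B ∧
      Φ.neighbourLaplace P T r B ≤ volume B * V (r - 2 * ε) := by
    intro ε hε
    let C : ℤ → Set ℝ := fun k => B ∩ Ico (k • ε) ((k + 1) • ε)
    have hC : ∀ k, MeasurableSet (C k) := fun k => hB.inter measurableSet_Ico
    have hd : Pairwise (Function.onFun Disjoint C) := fun j k hjk =>
      (pairwise_disjoint_Ico_zsmul ε hjk).mono inter_subset_right inter_subset_right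
    have hU : B = ⋃ k, C k := by
      rw [← inter_iUnion, iUnion_Ico_zsmul hε, inter_univ]
    have hs : ∀ k, C k ⊆ Metric.closedBall (k • ε) ε := by
      rintro k x ⟨-, hx⟩
      rw [add_smul, one_smul] at hx
      rw [Metric.mem_closedBall, Real.dist_eq, abs_le]
      constructor <;> linarith [hx.1, hx.2]
    have hvol : volume B = ∑' k, volume (C k) := by
      conv_lhs => rw [hU]
      exact measure_iUnion hd hC
    have hN : Φ.neighbourLaplace P T r B = ∑' k, Φ.neighbourLaplace P T r (C k) := by
      conv_lhs => rw [hU]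
      exact Φ.neighbourLaplace_iUnion P T r hC hd
    rw [hN, hvol, ← ENNReal.tsum_mul_right, ← ENNReal.tsum_mul_right]
    constructor
    · refine ENNReal.tsum_le_tsum fun k => ?_
      refine le_trans ?_ (Φ.palmLaplace_le_neighbourLaplace P T (hC k) (hs k))
      have := hlow (k • ε) (r + ε) ε (C k) (hC k) (hs k)
      rwa [show r + ε + ε = r + 2 * ε by ring] at this
    · refine ENNReal.tsum_le_tsum fun k => ?_
      refine (Φ.neighbourLaplace_le_palmLaplace P T (hC k) (hs k)).trans ?_
      have := hupp (k • ε) (r - ε) ε (C k) (hC k) (hs k)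
      rwa [show r - ε - ε = r - 2 * ε by ring] at this
  have lim : ∀ c : ℝ, Tendsto (fun ε : ℝ => volume B * V (r + c * ε)) (𝓝[>] 0)
      (𝓝 (volume B * V r)) := by
    intro c
    refine ENNReal.Tendsto.const_mul ?_ (.inr hB')
    have h1 : Tendsto (fun ε : ℝ => r + c * ε) (𝓝 0) (𝓝 r) := by
      have : Continuous fun ε : ℝ => r + c * ε := by fun_prop
      simpa using this.tendsto 0
    exact (hV.tendsto.comp h1).mono_left nhdsWithin_le_nhds
  apply le_antisymm
  · refine ge_of_tendsto (lim (-2)) ?_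
    filter_upwards [self_mem_nhdsWithin] with ε hε
    have := (key ε hε).2
    rwa [show r - 2 * ε = r + -2 * ε by ring] at this
  · refine le_of_tendsto (lim 2) ?_
    filter_upwards [self_mem_nhdsWithin] with ε hε
    exact (key ε hε).1

variable [Countable ι]

theorem meanCount_eq_neighbourLaplace (Φ : PointProcess Ω ι) (P : Measure Ω) (r : ℝ) {B : Set ℝ}
    (hB : MeasurableSet B) : Φ.meanCount P B = Φ.neighbourLaplace P 0 r B := by
  have := Φ.lintegral_config_mul P hB (W := fun _ => 1) measurable_const
  simpa [meanCount, neighbourLaplace, expNeg_zero] using this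

theorem measurable_connectivityDegree (Rb : ℝ) : Measurable (connectivityDegree Rb) :=
  Measure.measurable_coe measurableSet_closedBall

theorem lintegral_reducedPalm (Φ : PointProcess Ω ι) (P : Measure Ω) (T : ℝ≥0∞) (Rb : ℝ)
    (B : Set ℝ) :
    ∫⁻ μ, expNeg (T * connectivityDegree Rb μ) ∂(Φ.reducedPalm P B) =
      (Φ.meanCount P B)⁻¹ * Φ.neighbourLaplace P T (Rb / 2) B := by
  rw [reducedPalm, lintegral_smul_measure, lintegral_sum_measure, smul_eq_mul, neighbourLaplace]
  congr 2 with i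
  have hm : Measurable fun μ => expNeg (T * connectivityDegree Rb μ) :=
    measurable_expNeg.comp (measurable_const.mul (measurable_connectivityDegree Rb))
  rw [lintegral_map hm (Φ.measurable_othersSeenFrom i)]
  simp_rw [connectivityDegree, Φ.othersSeenFrom_closedBall]

theorem isProbabilityMeasure_reducedPalm (Φ : PointProcess Ω ι) (P : Measure Ω) {B : Set ℝ}
    (h0 : Φ.meanCount P B ≠ 0) (h1 : Φ.meanCount P B ≠ ∞) (hB : MeasurableSet B) :
    IsProbabilityMeasure (Φ.reducedPalm P B) := by
  constructor
  have := Φ.lintegral_reducedPalm P 0 0 B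
  simp only [zero_mul, expNeg_zero, lintegral_one] at this
  rw [this, ← Φ.meanCount_eq_neighbourLaplace P _ hB, ENNReal.inv_mul_cancel h0 h1]

end PointProcess

/-! ### Overlap of two intervals -/

section Overlap

theorem overlap_eq (r a x : ℝ) : overlap r a x = max (min r (x + a) - max (-r) (x - a)) 0 := by
  rw [overlap, Real.closedBall_eq_Icc, Real.closedBall_eq_Icc, Icc_inter_Icc,
    Real.volume_real_Icc, zero_sub, zero_add]

theorem continuous_overlapBar (a : ℝ) : Continuous fun p : ℝ × ℝ => overlapBar p.1 a p.2 := by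
  simp only [overlapBar, overlap_eq]
  fun_prop

theorem overlapBar_neg (r a x : ℝ) : overlapBar r a (-x) = overlapBar r a x := by
  rw [overlapBar, overlapBar, overlap_eq, overlap_eq]
  congr 2
  have h1 : min r (-x + a) = -max (-r) (x - a) := by
    rw [← min_neg_neg, neg_neg, neg_sub, neg_add_eq_sub]
  have h2 : max (-r) (-x - a) = -min r (x + a) := by
    rw [← max_neg_neg, neg_add, ← sub_eq_add_neg]
  rw [h1, h2]
  ring

theorem overlapBar_abs (r a x : ℝ) : overlapBar r a |x| = overlapBar r a x := by
  rcases abs_choice x with h | h <;> simp [h, overlapBar_neg]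

theorem overlapBar_nonneg {a : ℝ} (ha : 0 < a) (r x : ℝ) : 0 ≤ overlapBar r a x :=
  div_nonneg measureReal_nonneg (by positivity)

theorem overlapBar_eq_zero {r a x : ℝ} (h : r + a ≤ x) : overlapBar r a x = 0 := by
  rw [overlapBar, overlap_eq, max_eq_right, zero_div]
  have h1 := min_le_left r (x + a)
  have h2 := le_max_right (-r) (x - a)
  linarith

/-- A daughter of a parent at `x` lands in the ball with probability equal to the normalized
overlap. -/
theorem offsetMean_thinning_closedBall {a : ℝ} (ha : 0 < a) (t ρ x y : ℝ) :
    offsetMean a (thinning t (Metric.closedBall y ρ)) x =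
      (1 - Real.exp (-t)) * overlapBar ρ a (x - y) := by
  have e : (fun u => thinning t (Metric.closedBall y ρ) (x + u)) =
      (Icc (y - x - ρ) (y - x + ρ)).indicator fun _ => 1 - Real.exp (-t) := by
    funext u
    have : x + u ∈ Metric.closedBall y ρ ↔ u ∈ Icc (y - x - ρ) (y - x + ρ) := by
      rw [Real.closedBall_eq_Icc, mem_Icc, mem_Icc]
      constructor <;> rintro ⟨h1, h2⟩ <;> constructor <;> linarith
    by_cases h : x + u ∈ Metric.closedBall y ρ
    · simp only [thinning, indicator_of_mem h, indicator_of_mem (this.1 h)]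
    · simp only [thinning, indicator_of_notMem h, indicator_of_notMem (fun h' => h (this.2 h'))]
  rw [offsetMean, e, integral_indicator measurableSet_Icc, setIntegral_const, smul_eq_mul, mul_comm,
    measureReal_def, cond_apply measurableSet_closedBall, ENNReal.toReal_mul, ENNReal.toReal_inv,
    ← measureReal_def, ← measureReal_def, Real.volume_real_closedBall ha.le,
    Real.closedBall_eq_Icc, Icc_inter_Icc, Real.volume_real_Icc, overlapBar, overlap_eq,
    zero_sub, zero_add, inv_mul_eq_div]
  congr 3
  have h1 : min a (y - x + ρ) = min ρ (x - y + a) + (y - x) := by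
    rw [← min_add_add_right, min_comm]; congr 1 <;> ring
  have h2 : max (-a) (y - x - ρ) = max (-ρ) (x - y - a) + (y - x) := by
    rw [← max_add_add_right, max_comm]; congr 1 <;> ring
  rw [h1, h2]
  ring

theorem thinning_mono {t : ℝ} (ht : 0 ≤ t) {D E : Set ℝ} (h : D ⊆ E) (x : ℝ) :
    thinning t D x ≤ thinning t E x :=
  indicator_le_indicator_of_subset h (fun _ => by simpa using ht) x

theorem overlapBar_mono {a : ℝ} (ha : 0 < a) {r ρ : ℝ} (h : r ≤ ρ) (x : ℝ) :
    overlapBar r a x ≤ overlapBar ρ a x := by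
  unfold overlapBar overlap
  have hf : volume (Metric.closedBall (0 : ℝ) ρ ∩ Metric.closedBall x a) ≠ ∞ :=
    measure_ne_top_of_subset inter_subset_left measure_closedBall_lt_top.ne
  gcongr

/-- The bounds required by `PointProcess.neighbourLaplace_eq` put no sign on `ε`; a negative one
forces `B` to be empty. -/
theorem volume_eq_zero_or_nonneg_of_subset_closedBall {y ε : ℝ} {B : Set ℝ}
    (h : B ⊆ Metric.closedBall y ε) : volume B = 0 ∨ 0 ≤ ε := by
  by_cases he : 0 ≤ ε
  · exact .inr he
  · rw [Metric.closedBall_eq_empty.2 (not_le.1 he), subset_empty_iff] at h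
    simp [h]

end Overlap

/-! ### Monotonicity and continuity in the radius -/

section ClusterTransform

variable {lamP m a t : ℝ}

/-- The exponent of the transform at `t` of the number of points of a cluster process in a ball
of radius `ρ`. -/
noncomputable def clusterExponent (m a t ρ : ℝ) : ℝ :=
  ∫ x, (1 - Real.exp (-(m * ((1 - Real.exp (-t)) * overlapBar ρ a x))))

/-- The transform at `t` of the number of points at distance at most `ρ` in the cluster of the
typical point. -/
noncomputable def ownClusterTransform (m a t ρ : ℝ) : ℝ :=
  ∫ u, Real.exp (-(m * ((1 - Real.exp (-t)) * overlapBar ρ a u)))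
    ∂(cond volume (Metric.closedBall (0 : ℝ) a))

theorem integrable_clusterExponent (hm : 0 < m) (ha : 0 < a) (ht : 0 ≤ t) (ρ : ℝ) :
    Integrable fun x => 1 - Real.exp (-(m * ((1 - Real.exp (-t)) * overlapBar ρ a x))) := by
  have mD : MeasurableSet (Metric.closedBall (0 : ℝ) ρ) := measurableSet_closedBall
  have h := integrable_one_sub_exp hm.le (integrable_offsetMean ha (measurable_thinning t mD)
    (thinning_nonneg ht _) (thinning_le_one t _)
    (integrable_thinning t mD measure_closedBall_lt_top.ne))
    (offsetMean_nonneg (thinning_nonneg ht _))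
  simpa only [offsetMean_thinning_closedBall ha, sub_zero] using h

theorem integral_offsetMean_thinning_closedBall (ha : 0 < a) (y ρ : ℝ) :
    ∫ x, (1 - Real.exp (-(m * offsetMean a (thinning t (Metric.closedBall y ρ)) x))) =
      clusterExponent m a t ρ := by
  simp_rw [offsetMean_thinning_closedBall ha]
  exact integral_sub_right_eq_self
    (fun x => 1 - Real.exp (-(m * ((1 - Real.exp (-t)) * overlapBar ρ a x)))) y

theorem exp_overlapBar_anti (hm : 0 < m) (ha : 0 < a) (ht : 0 ≤ t) {r ρ : ℝ} (h : r ≤ ρ) (x : ℝ) :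
    Real.exp (-(m * ((1 - Real.exp (-t)) * overlapBar ρ a x))) ≤
      Real.exp (-(m * ((1 - Real.exp (-t)) * overlapBar r a x))) := by
  have hβ : 0 ≤ 1 - Real.exp (-t) := by simpa using ht
  have := overlapBar_mono ha h x
  gcongr

theorem clusterExponent_mono (hm : 0 < m) (ha : 0 < a) (ht : 0 ≤ t) :
    Monotone (clusterExponent m a t) := fun r ρ h =>
  integral_mono (integrable_clusterExponent hm ha ht r) (integrable_clusterExponent hm ha ht ρ)
    fun x => sub_le_sub_left (exp_overlapBar_anti hm ha ht h x) 1

theorem continuous_exp_overlapBar_left (m a t x : ℝ) :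
    Continuous fun ρ => Real.exp (-(m * ((1 - Real.exp (-t)) * overlapBar ρ a x))) := by
  have : Continuous fun ρ => overlapBar ρ a x :=
    (continuous_overlapBar a).comp (continuous_id.prodMk continuous_const)
  fun_prop

theorem continuous_exp_overlapBar_right (m a t ρ : ℝ) :
    Continuous fun x => Real.exp (-(m * ((1 - Real.exp (-t)) * overlapBar ρ a x))) := by
  have : Continuous fun x => overlapBar ρ a x :=
    (continuous_overlapBar a).comp (continuous_const.prodMk continuous_id)
  fun_prop

theorem exp_overlapBar_le_one (hm : 0 < m) (ha : 0 < a) (ht : 0 ≤ t) (ρ x : ℝ) :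
    Real.exp (-(m * ((1 - Real.exp (-t)) * overlapBar ρ a x))) ≤ 1 := by
  have hβ : 0 ≤ 1 - Real.exp (-t) := by simpa using ht
  simpa using mul_nonneg hm.le (mul_nonneg hβ (overlapBar_nonneg ha ρ x))

theorem continuousAt_clusterExponent (hm : 0 < m) (ha : 0 < a) (ht : 0 ≤ t) (r : ℝ) :
    ContinuousAt (clusterExponent m a t) r := by
  refine continuousAt_of_dominated
    -- The integrand increases with the radius, so its value at `r + 1` dominates near `r`.
    (bound := fun x => 1 - Real.exp (-(m * ((1 - Real.exp (-t)) * overlapBar (r + 1) a x))))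
    (.of_forall fun ρ => (integrable_clusterExponent hm ha ht ρ).1) ?_
    (integrable_clusterExponent hm ha ht _)
    (.of_forall fun x => (continuous_const.sub (continuous_exp_overlapBar_left m a t x)).continuousAt)
  filter_upwards [Iic_mem_nhds (lt_add_one r)] with ρ hρ
  refine .of_forall fun x => ?_
  rw [Real.norm_eq_abs, abs_of_nonneg (sub_nonneg.2 (exp_overlapBar_le_one hm ha ht ρ x))]
  exact sub_le_sub_left (exp_overlapBar_anti hm ha ht hρ x) 1

theorem integrable_ownCluster (hm : 0 < m) (ha : 0 < a) (ht : 0 ≤ t) (ρ : ℝ) :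
    Integrable (fun u => Real.exp (-(m * ((1 - Real.exp (-t)) * overlapBar ρ a u))))
      (cond volume (Metric.closedBall (0 : ℝ) a)) := by
  have := MaternCluster.isProbabilityMeasure_cond_closedBall ha
  refine Integrable.of_bound (continuous_exp_overlapBar_right m a t ρ).aestronglyMeasurable 1
    (.of_forall fun u => ?_)
  rw [Real.norm_eq_abs, Real.abs_exp]
  exact exp_overlapBar_le_one hm ha ht ρ u

theorem continuousAt_ownClusterTransform (hm : 0 < m) (ha : 0 < a) (ht : 0 ≤ t) (r : ℝ) :
    ContinuousAt (ownClusterTransform m a t) r := by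
  have := MaternCluster.isProbabilityMeasure_cond_closedBall ha
  refine continuousAt_of_dominated (bound := fun _ => 1)
    (.of_forall fun ρ => (integrable_ownCluster hm ha ht ρ).1) (.of_forall fun ρ =>
      .of_forall fun x => ?_) (integrable_const _)
    (.of_forall fun x => (continuous_exp_overlapBar_left m a t x).continuousAt)
  rw [Real.norm_eq_abs, Real.abs_exp]
  exact exp_overlapBar_le_one hm ha ht ρ x

end ClusterTransform

/-! ### Transforms of the number of neighbours -/

section NeighbourTransforms

variable {Ω : Type*} [MeasurableSpace Ω] {P : Measure Ω} [IsProbabilityMeasure P]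

theorem PointProcess.IsPoisson.neighbourLaplace_eq {ι : Type*} [Countable ι]
    {Φ : PointProcess Ω ι} {lam : ℝ} (h : Φ.IsPoisson P lam) (hlam : 0 < lam) {t : ℝ} (ht : 0 ≤ t)
    (r : ℝ) {B : Set ℝ} (hB : MeasurableSet B) (hB' : volume B ≠ ∞) :
    Φ.neighbourLaplace P (ENNReal.ofReal t) r B = volume B * ENNReal.ofReal (lam * Real.exp
      (-(lam * ((1 - Real.exp (-t)) * volume.real (Metric.closedBall (0 : ℝ) r))))) := by
  have hβ : 0 ≤ 1 - Real.exp (-t) := by simpa using ht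
  let V : ℝ → ℝ≥0∞ := fun ρ => ENNReal.ofReal (lam * Real.exp
      (-(lam * ((1 - Real.exp (-t)) * volume.real (Metric.closedBall (0 : ℝ) ρ)))))
  have hVa : Antitone V := fun r ρ h => by
    have : volume.real (Metric.closedBall (0 : ℝ) r) ≤ volume.real (Metric.closedBall (0 : ℝ) ρ) :=
      measureReal_mono (Metric.closedBall_subset_closedBall h) measure_closedBall_lt_top.ne
    simp only [V]
    gcongr
  have hVc : Continuous V := by
    simp only [V, Real.closedBall_eq_Icc, Real.volume_real_Icc]
    exact ENNReal.continuous_ofReal.comp (by fun_prop)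
  have hfin : ∀ (y ε : ℝ) (B : Set ℝ), B ⊆ Metric.closedBall y ε → volume B ≠ ∞ :=
    fun y ε B h => measure_ne_top_of_subset h measure_closedBall_lt_top.ne
  have hp : ∀ (y ρ ε : ℝ) (B : Set ℝ), MeasurableSet B → B ⊆ Metric.closedBall y ε →
      Φ.palmLaplace P (ENNReal.ofReal t) (Metric.closedBall y ρ) B = volume B * V ρ := by
    intro y ρ ε B hB hs
    rw [h.palmLaplace_eq hlam ht measurableSet_closedBall measure_closedBall_lt_top.ne hB
      (hfin _ _ _ hs)]
    simp only [V, Real.closedBall_eq_Icc, Real.volume_real_Icc]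
    ring_nf
  refine Φ.neighbourLaplace_eq P _ hVc.continuousAt (fun y ρ ε B hB hs => ?_)
    (fun y ρ ε B hB hs => ?_) hB hB'
  · rw [hp y ρ ε B hB hs]
    rcases volume_eq_zero_or_nonneg_of_subset_closedBall hs with h0 | h0
    · simp [h0]
    · exact mul_le_mul_right (hVa (by linarith)) _
  · rw [hp y ρ ε B hB hs]
    rcases volume_eq_zero_or_nonneg_of_subset_closedBall hs with h0 | h0
    · simp [h0]
    · exact mul_le_mul_right (hVa (by linarith)) _

/-- The Palm density at `z` for a ball about `y` depends on `z - y`. For `z` within `ε` of `y`, that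
ball lies between the balls about `z` of radii `ρ - ε` and `ρ + ε`, for which the density is
explicit. -/
theorem MaternCluster.neighbourLaplace_eq {κ : Type*} [Countable κ] {lamP m a : ℝ}
    (M : MaternCluster P κ lamP m a) (hl : 0 < lamP) (hm : 0 < m) (ha : 0 < a) {t : ℝ}
    (ht : 0 ≤ t) (r : ℝ) {B : Set ℝ} (hB : MeasurableSet B) (hB' : volume B ≠ ∞) :
    M.points.neighbourLaplace P (ENNReal.ofReal t) r B = volume B * ENNReal.ofReal
      (lamP * m * Real.exp (-(lamP * clusterExponent m a t r)) * ownClusterTransform m a t r) := by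
  have := isProbabilityMeasure_cond_closedBall ha
  have mD : ∀ y ρ : ℝ, MeasurableSet (Metric.closedBall y ρ) := fun _ _ => measurableSet_closedBall
  let V : ℝ → ℝ≥0∞ := fun ρ => ENNReal.ofReal
    (lamP * m * Real.exp (-(lamP * clusterExponent m a t ρ)) * ownClusterTransform m a t ρ)
  have hVc : ContinuousAt V r := by
    refine ENNReal.continuous_ofReal.continuousAt.comp ?_
    exact (continuousAt_const.mul (Real.continuous_exp.continuousAt.comp
      (continuousAt_const.mul (continuousAt_clusterExponent hm ha ht r)).neg)).mul
      (continuousAt_ownClusterTransform hm ha ht r)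
  have hE : ∀ r ρ, r ≤ ρ → Real.exp (-(lamP * clusterExponent m a t ρ)) ≤
      Real.exp (-(lamP * clusterExponent m a t r)) := fun r ρ h => by
    have := clusterExponent_mono hm ha ht h
    gcongr
  have hown : ∀ ρ z : ℝ, ∫⁻ u, ENNReal.ofReal (Real.exp (-(m * offsetMean a
      (thinning t (Metric.closedBall z ρ)) (z - u)))) ∂(cond volume (Metric.closedBall (0 : ℝ) a)) =
      ENNReal.ofReal (ownClusterTransform m a t ρ) := by
    intro ρ z
    rw [ownClusterTransform, ofReal_integral_eq_lintegral_ofReal (integrable_ownCluster hm ha ht ρ)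
      (.of_forall fun u => (Real.exp_pos _).le)]
    simp_rw [offsetMean_thinning_closedBall ha, sub_sub_cancel_left, overlapBar_neg]
  have hmono : ∀ (D E : Set ℝ), MeasurableSet D → MeasurableSet E → D ⊆ E → ∀ z : ℝ,
      ∫⁻ u, ENNReal.ofReal (Real.exp (-(m * offsetMean a (thinning t E) (z - u))))
        ∂(cond volume (Metric.closedBall (0 : ℝ) a)) ≤
      ∫⁻ u, ENNReal.ofReal (Real.exp (-(m * offsetMean a (thinning t D) (z - u))))
        ∂(cond volume (Metric.closedBall (0 : ℝ) a)) := by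
    intro D E hD hE h z
    refine lintegral_mono fun u => ENNReal.ofReal_le_ofReal (Real.exp_le_exp.2 (neg_le_neg ?_))
    exact mul_le_mul_of_nonneg_left (offsetMean_mono ha (measurable_thinning t hD)
      (thinning_nonneg ht _) (measurable_thinning t hE) (thinning_le_one t _)
      (thinning_mono ht h) _) hm.le
  have hfin : ∀ (y ε : ℝ) (B : Set ℝ), B ⊆ Metric.closedBall y ε → volume B ≠ ∞ :=
    fun y ε B h => measure_ne_top_of_subset h measure_closedBall_lt_top.ne
  have hV : ∀ (ρ : ℝ) (B : Set ℝ), volume B * V ρ = ENNReal.ofReal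
      (lamP * m * Real.exp (-(lamP * clusterExponent m a t ρ))) *
        ∫⁻ _ in B, ENNReal.ofReal (ownClusterTransform m a t ρ) := by
    intro ρ B
    simp only [V]
    rw [setLIntegral_const, ENNReal.ofReal_mul (by positivity)]
    ring
  refine M.points.neighbourLaplace_eq P _ hVc (fun y ρ ε B hB hs => ?_)
    (fun y ρ ε B hB hs => ?_) hB hB'
  · rw [M.palmLaplace_eq hl hm ha ht (mD _ _) measure_closedBall_lt_top.ne hB (hfin _ _ _ hs),
      integral_offsetMean_thinning_closedBall ha, hV]
    rcases volume_eq_zero_or_nonneg_of_subset_closedBall hs with h0 | h0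
    · simp [Measure.restrict_eq_zero.2 h0]
    · refine mul_le_mul' (ENNReal.ofReal_le_ofReal (mul_le_mul_of_nonneg_left
        (hE _ _ (by linarith)) (by positivity))) (setLIntegral_mono' hB fun z hz => ?_)
      rw [← hown (ρ + ε) z]
      refine hmono _ _ (mD _ _) (mD _ _) (Metric.closedBall_subset_closedBall' ?_) z
      have := hs hz
      rw [Metric.mem_closedBall, dist_comm] at this
      linarith
  · rw [M.palmLaplace_eq hl hm ha ht (mD _ _) measure_closedBall_lt_top.ne hB (hfin _ _ _ hs),
      integral_offsetMean_thinning_closedBall ha, hV]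
    rcases volume_eq_zero_or_nonneg_of_subset_closedBall hs with h0 | h0
    · simp [Measure.restrict_eq_zero.2 h0]
    · refine mul_le_mul' (ENNReal.ofReal_le_ofReal (mul_le_mul_of_nonneg_left
        (hE _ _ (by linarith)) (by positivity))) (setLIntegral_mono' hB fun z hz => ?_)
      rw [← hown (ρ - ε) z]
      refine hmono _ _ (mD _ _) (mD _ _) (Metric.closedBall_subset_closedBall' ?_) z
      have := hs hz
      rw [Metric.mem_closedBall] at this
      linarith

/-- The transform of the number of points of a Matérn cluster process in a ball. -/
theorem MaternCluster.lintegral_expNeg_count {κ : Type*} [Countable κ] {lamP m a : ℝ}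
    (M : MaternCluster P κ lamP m a) (hl : 0 < lamP) (hm : 0 < m) (ha : 0 < a) {t : ℝ}
    (ht : 0 ≤ t) (c r : ℝ) :
    ∫⁻ ω, expNeg (ENNReal.ofReal t * M.points.config ω (Metric.closedBall c r)) ∂P =
      ENNReal.ofReal (Real.exp (-(lamP * clusterExponent m a t r))) := by
  have mD : MeasurableSet (Metric.closedBall c r) := measurableSet_closedBall
  have h := M.lintegral_expNeg_points_eq_exp hl hm ha (measurable_mul_indicator
    (ENNReal.ofReal t) mD) (measurable_thinning t mD) (thinning_nonneg ht _) (thinning_le_one t _)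
    (integrable_thinning t mD measure_closedBall_lt_top.ne) (fun x => by
      rw [expNeg_mul_indicator ht, ← ENNReal.ofReal_one,
        ← ENNReal.ofReal_sub _ (sub_nonneg.2 (thinning_le_one t _ x)), sub_sub_cancel])
  rw [integral_offsetMean_thinning_closedBall ha] at h
  simpa only [lintegral_const_mul _ (measurable_one.indicator mD), lintegral_indicator_one mD] using h

end NeighbourTransforms

/-! ### Faà di Bruno's formula for the exponential of a power series -/

section PowerSeriesExp

theorem mem_faaDiBrunoTuples {k : ℕ} {b : Fin k → ℕ} :
    b ∈ faaDiBrunoTuples k ↔ ∑ i : Fin k, ((i : ℕ) + 1) * b i = k := by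
  simp only [faaDiBrunoTuples, Finset.mem_filter, Fintype.mem_piFinset, Finset.mem_range,
    and_iff_right_iff_imp]
  intro h i
  have h1 : ((i : ℕ) + 1) * b i ≤ k := by
    conv_rhs => rw [← h]
    exact Finset.single_le_sum (f := fun i : Fin k => ((i : ℕ) + 1) * b i)
      (fun _ _ => Nat.zero_le _) (Finset.mem_univ i)
  nlinarith [Nat.zero_le ((i : ℕ) * b i)]

variable {c : ℕ → ℝ}

/-- The two bases agree modulo `X ^ (k + 1)`, hence so do their powers. The finite sum is open to
the multinomial theorem. -/
theorem coeff_mk_pow_eq (h0 : c 0 = 0) (n k : ℕ) :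
    PowerSeries.coeff k (PowerSeries.mk c ^ n) = PowerSeries.coeff k
      ((∑ i : Fin k, PowerSeries.monomial ((i : ℕ) + 1) (c ((i : ℕ) + 1))) ^ n) := by
  rw [← sub_eq_zero, ← map_sub]
  refine PowerSeries.X_pow_dvd_iff.1 (dvd_trans (PowerSeries.X_pow_dvd_iff.2 fun m hm => ?_)
    (sub_dvd_pow_sub_pow _ _ n)) k (Nat.lt_succ_self k)
  rw [map_sub, map_sum, PowerSeries.coeff_mk, sub_eq_zero]
  simp_rw [PowerSeries.coeff_monomial]
  rcases m with _ | m
  · simp [h0]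
  · rw [Finset.sum_eq_single (⟨m, by omega⟩ : Fin k)]
    · simp
    · intro i _ hi
      rw [if_neg]
      intro e
      exact hi (Fin.ext (by simp at e ⊢; omega))
    · simp

/-- In the multinomial expansion `b i` counts the factors of degree `i + 1`, so only tuples of
weight `k` survive; `n!` cancels from the multinomial coefficient. -/
theorem coeff_mk_pow_div_factorial (h0 : c 0 = 0) (n k : ℕ) :
    PowerSeries.coeff k (PowerSeries.mk c ^ n) / n.factorial =
      ∑ b ∈ faaDiBrunoTuples k with ∑ i, b i = n,
        ∏ i : Fin k, c ((i : ℕ) + 1) ^ b i / (b i).factorial := by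
  have hprod : ∀ b : Fin k → ℕ,
      ∏ i : Fin k, PowerSeries.monomial ((i : ℕ) + 1) (c ((i : ℕ) + 1)) ^ b i =
        PowerSeries.monomial (∑ i : Fin k, ((i : ℕ) + 1) * b i)
          (∏ i : Fin k, c ((i : ℕ) + 1) ^ b i) := by
    intro b
    simp_rw [PowerSeries.monomial_pow, mul_comm (b _)]
    induction (Finset.univ : Finset (Fin k)) using Finset.induction_on with
    | empty => simp
    | insert i s hi ih =>
      rw [Finset.prod_insert hi, Finset.prod_insert hi, Finset.sum_insert hi, ih,
        PowerSeries.monomial_mul_monomial]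
  have hs : (faaDiBrunoTuples k).filter (fun b => ∑ i, b i = n) =
      (Finset.piAntidiag Finset.univ n).filter
        (fun b : Fin k → ℕ => ∑ i : Fin k, ((i : ℕ) + 1) * b i = k) := by
    ext b
    simp [mem_faaDiBrunoTuples, and_comm]
  rw [coeff_mk_pow_eq h0, Finset.sum_pow_eq_sum_piAntidiag, map_sum, Finset.sum_div, hs,
    Finset.sum_filter]
  refine Finset.sum_congr rfl fun b hb => ?_
  rw [hprod, ← map_natCast (PowerSeries.C (R := ℝ)), PowerSeries.coeff_C_mul,
    PowerSeries.coeff_monomial]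
  have hn : ∑ i, b i = n := (Finset.mem_piAntidiag.1 hb).1
  by_cases h : ∑ i : Fin k, ((i : ℕ) + 1) * b i = k
  · rw [if_pos h.symm, if_pos h, Finset.prod_div_distrib]
    have hm := Nat.multinomial_spec (s := Finset.univ) (f := b)
    rw [hn] at hm
    have hm' : (∏ i, ((b i).factorial : ℝ)) * (Nat.multinomial Finset.univ b : ℝ) = n.factorial := by
      exact_mod_cast hm
    have h1 : (∏ i, ((b i).factorial : ℝ)) ≠ 0 :=
      Finset.prod_ne_zero_iff.2 fun i _ => by positivity
    have h2 : (n.factorial : ℝ) ≠ 0 := by positivity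
    rw [div_eq_div_iff h2 h1, ← hm']
    ring
  · rw [if_neg (fun e => h e.symm), if_neg h, mul_zero, zero_div]

theorem sum_coeff_mk_pow_div_factorial (h0 : c 0 = 0) (k : ℕ) :
    ∑ n ∈ Finset.range (k + 1), PowerSeries.coeff k (PowerSeries.mk c ^ n) / n.factorial =
      ∑ b ∈ faaDiBrunoTuples k, ∏ i : Fin k, c ((i : ℕ) + 1) ^ b i / (b i).factorial := by
  simp_rw [coeff_mk_pow_div_factorial h0]
  refine Finset.sum_fiberwise_of_maps_to (fun b hb => ?_) _
  rw [Finset.mem_range, Nat.lt_succ_iff]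
  conv_rhs => rw [← mem_faaDiBrunoTuples.1 hb]
  -- A tuple of weight `k` has at most `k` factors, so `n ≤ k` covers all of them.
  exact Finset.sum_le_sum fun i _ => Nat.le_mul_of_pos_left _ (Nat.succ_pos _)

theorem coeff_mk_pow_eq_zero (h0 : c 0 = 0) {n k : ℕ} (h : k < n) :
    PowerSeries.coeff k (PowerSeries.mk c ^ n) = 0 := by
  have h1 : PowerSeries.X ∣ PowerSeries.mk c := by
    rw [PowerSeries.X_dvd_iff]
    simpa using h0
  exact PowerSeries.X_pow_dvd_iff.1 (pow_dvd_pow_of_dvd h1 n) k h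

theorem hasSum_mul_antidiagonal {f g : ℕ → ℝ} {F G : ℝ → ℝ}
    (hf : ∀ s : ℝ, HasSum (fun k => f k * s ^ k) (F s))
    (hg : ∀ s : ℝ, HasSum (fun k => g k * s ^ k) (G s)) (s : ℝ) :
    HasSum (fun k => (∑ p ∈ Finset.HasAntidiagonal.antidiagonal k, f p.1 * g p.2) * s ^ k) (F s * G s) := by
  have hf' := (hf s).summable.norm
  have hg' := (hg s).summable.norm
  have h1 := (summable_norm_sum_mul_antidiagonal_of_summable_norm hf' hg').of_norm.hasSum
  rw [← tsum_mul_tsum_eq_tsum_sum_antidiagonal_of_summable_norm hf' hg', (hf s).tsum_eq,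
    (hg s).tsum_eq] at h1
  refine h1.congr_fun fun k => ?_
  rw [Finset.sum_mul]
  refine Finset.sum_congr rfl fun p hp => ?_
  rw [← Finset.HasAntidiagonal.mem_antidiagonal.1 hp, pow_add]
  ring

theorem hasSum_coeff_mk_pow {C : ℝ → ℝ} (hC : ∀ s : ℝ, HasSum (fun k => c k * s ^ k) (C s))
    (n : ℕ) (s : ℝ) :
    HasSum (fun k => PowerSeries.coeff k (PowerSeries.mk c ^ n) * s ^ k) (C s ^ n) := by
  induction n generalizing s with
  | zero =>
    convert hasSum_single (f := fun k => PowerSeries.coeff k (PowerSeries.mk c ^ 0) * s ^ k) 0 ?_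
    · simp
    · intro k hk
      simp [PowerSeries.coeff_one, hk]
  | succ n ih =>
    have := hasSum_mul_antidiagonal ih hC s
    simp_rw [pow_succ, PowerSeries.coeff_mul, PowerSeries.coeff_mk]
    exact this

/-- The exponential of a power series with nonnegative coefficients, by Faà di Bruno's formula. -/
theorem hasSum_exp_powerSeries (h0 : c 0 = 0) (hc : ∀ k, 0 ≤ c k) {C : ℝ → ℝ}
    (hC : ∀ s : ℝ, HasSum (fun k => c k * s ^ k) (C s)) (s : ℝ) :
    HasSum (fun k => (∑ b ∈ faaDiBrunoTuples k,
      ∏ i : Fin k, c ((i : ℕ) + 1) ^ b i / (b i).factorial) * s ^ k) (Real.exp (C s)) := by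
  let e : ℕ → ℕ → ℝ := fun n k => PowerSeries.coeff k (PowerSeries.mk c ^ n) / n.factorial
  have he : ∀ n k, 0 ≤ e n k := by
    intro n k
    simp only [e]
    rw [coeff_mk_pow_div_factorial h0]
    exact Finset.sum_nonneg fun b _ => Finset.prod_nonneg fun i _ =>
      div_nonneg (pow_nonneg (hc _) _) (Nat.cast_nonneg _)
  have hrow : ∀ (s : ℝ) n, HasSum (fun k => e n k * s ^ k) (C s ^ n / n.factorial) := by
    intro s n
    refine ((hasSum_coeff_mk_pow hC n s).div_const (n.factorial : ℝ)).congr_fun fun k => ?_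
    simp only [e]
    ring
  have hexp : HasSum (fun n => C s ^ n / n.factorial) (Real.exp (C s)) := by
    rw [Real.exp_eq_exp_ℝ]
    exact NormedSpace.expSeries_div_hasSum_exp (C s)
  -- Since the coefficients are nonnegative, the absolute double series is the same one at `|s|`,
  -- with sum `exp (C |s|)`. This permits summing by columns instead of rows.
  have hsum : Summable fun p : ℕ × ℕ => e p.1 p.2 * s ^ p.2 := by
    refine Summable.of_norm ?_
    have e1 : ∀ p : ℕ × ℕ, ‖e p.1 p.2 * s ^ p.2‖ = e p.1 p.2 * |s| ^ p.2 := fun p => by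
      rw [norm_mul, norm_pow, Real.norm_eq_abs, Real.norm_eq_abs, abs_of_nonneg (he _ _)]
    simp_rw [e1]
    rw [summable_prod_of_nonneg fun p => mul_nonneg (he _ _) (pow_nonneg (abs_nonneg s) _)]
    refine ⟨fun n => (hrow |s| n).summable, ?_⟩
    simp_rw [(hrow |s| _).tsum_eq]
    exact (NormedSpace.expSeries_div_hasSum_exp (C |s|)).summable
  have htot : HasSum (fun p : ℕ × ℕ => e p.1 p.2 * s ^ p.2) (Real.exp (C s)) := by
    have h1 := hsum.hasSum
    have h2 := h1.prod_fiberwise fun n => hrow s n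
    rwa [h2.unique hexp] at h1
  have hcol : ∀ k, HasSum (fun n => e n k * s ^ k)
      ((∑ b ∈ faaDiBrunoTuples k,
        ∏ i : Fin k, c ((i : ℕ) + 1) ^ b i / (b i).factorial) * s ^ k) := by
    intro k
    rw [← sum_coeff_mk_pow_div_factorial h0, Finset.sum_mul]
    refine hasSum_sum_of_ne_finset_zero fun n hn => ?_
    simp only [e]
    rw [coeff_mk_pow_eq_zero h0 (by simpa using hn), zero_div, zero_mul]
  have hswap : HasSum (fun p : ℕ × ℕ => e p.2 p.1 * s ^ p.1) (Real.exp (C s)) :=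
    (Equiv.prodComm ℕ ℕ).hasSum_iff.2 htot
  exact hswap.prod_fiberwise hcol

end PowerSeriesExp

/-! ### A transform determines the mass function -/

section Uniqueness

/-- Once the earlier coefficients vanish, divide by `s ^ k` and let `s` decrease to `0`; convergence
at `s = 1/2` supplies the domination. -/
theorem eq_zero_of_hasSum_pow_zero {d : ℕ → ℝ}
    (h : ∀ s : ℝ, 0 < s → s < 1 → HasSum (fun k => d k * s ^ k) 0) (k : ℕ) : d k = 0 := by
  induction k using Nat.strong_induction_on with
  | _ k ih =>
    have hs : ∀ s : ℝ, 0 < s → s < 1 → HasSum (fun n => d (n + k) * s ^ n) 0 := by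
      intro s h0 h1
      have h2 := (hasSum_nat_add_iff' k).2 (h s h0 h1)
      rw [Finset.sum_eq_zero (fun i hi => by rw [ih i (Finset.mem_range.1 hi), zero_mul]),
        sub_zero] at h2
      have h3 := h2.mul_left (s ^ k)⁻¹
      rw [mul_zero] at h3
      refine h3.congr_fun fun n => ?_
      rw [pow_add]
      field_simp
    have hbound : Summable fun n => |d (n + k)| * (1 / 2 : ℝ) ^ n := by
      refine (hs (1 / 2) (by norm_num) (by norm_num)).summable.norm.congr fun n => ?_
      rw [norm_mul, Real.norm_eq_abs, Real.norm_eq_abs,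
        abs_of_nonneg (a := (1 / 2 : ℝ) ^ n) (by positivity)]
    have hlim : Tendsto (fun s : ℝ => ∑' n, d (n + k) * s ^ n) (𝓝[>] 0)
        (𝓝 (∑' n, d (n + k) * 0 ^ n)) := by
      refine tendsto_tsum_of_dominated_convergence hbound (fun n => ?_) ?_
      · exact ((continuous_const.mul (continuous_pow n)).tendsto 0).mono_left nhdsWithin_le_nhds
      · filter_upwards [Ioo_mem_nhdsGT (by norm_num : (0 : ℝ) < 1 / 2)] with s hs n
        rw [norm_mul, norm_pow, Real.norm_eq_abs, Real.norm_eq_abs, abs_of_pos hs.1]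
        exact mul_le_mul_of_nonneg_left (pow_le_pow_left₀ hs.1.le hs.2.le n) (abs_nonneg _)
    have hzero : Tendsto (fun s : ℝ => ∑' n, d (n + k) * s ^ n) (𝓝[>] 0) (𝓝 0) := by
      refine tendsto_const_nhds.congr' ?_
      filter_upwards [Ioo_mem_nhdsGT (by norm_num : (0 : ℝ) < 1)] with s hs'
      exact ((hs s hs'.1 hs'.2).tsum_eq).symm
    have := tendsto_nhds_unique hlim hzero
    rwa [tsum_eq_single 0 (fun n hn => by rw [zero_pow hn, mul_zero]), pow_zero, mul_one,
      zero_add] at this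

/-- A count is determined by its Laplace transform. -/
theorem hasPGF_and_hasPMF_of_lintegral_expNeg {S : Type*} [MeasurableSpace S] {Q : Measure S}
    [IsProbabilityMeasure Q] {N : S → ℝ≥0∞} (hN : Measurable N)
    (hint : ∀ᵐ x ∂Q, ∃ n : ℕ∞, N x = n) {G : ℝ → ℝ} {p : ℕ → ℝ} (hG0 : ∀ s, 0 ≤ G s)
    (hp : ∀ s : ℝ, HasSum (fun k => p k * s ^ k) (G s))
    (h : ∀ t, 0 < t →
      ∫⁻ x, expNeg (ENNReal.ofReal t * N x) ∂Q = ENNReal.ofReal (G (Real.exp (-t)))) :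
    HasPGF Q N G ∧ HasPMF Q N p := by
  have mk : ∀ k : ℕ, MeasurableSet {x | N x = k} := fun k => hN (measurableSet_singleton _)
  have key : ∀ s : ℝ, 0 < s → s < 1 →
      HasSum (fun k : ℕ => Q.real {x | N x = k} * s ^ k) (G s) := by
    intro s h0 h1
    have ht : 0 < -Real.log s := neg_pos.2 (Real.log_neg h0 h1)
    have hs := h _ ht
    rw [neg_neg, Real.exp_log h0] at hs
    -- An infinite count contributes `0` to both sides because `-log s > 0`, so finiteness of `N`
    -- need not be known.
    have e1 : ∀ᵐ x ∂Q, expNeg (ENNReal.ofReal (-Real.log s) * N x) =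
        ∑' k : ℕ, {x | N x = k}.indicator (fun _ => ENNReal.ofReal s ^ k) x := by
      filter_upwards [hint] with x ⟨n, hn⟩
      induction n using ENat.recTopCoe with
      | top =>
        rw [hn, ENat.toENNReal_top, ENNReal.mul_top (by simpa using ht), expNeg_top]
        symm
        rw [ENNReal.tsum_eq_zero]
        intro k
        rw [indicator_of_notMem]
        simp [hn]
      | coe n =>
        rw [hn, ENat.toENNReal_coe, mul_comm, expNeg_nat_mul, expNeg_ofReal ht.le, neg_neg,
          Real.exp_log h0, tsum_eq_single n]
        · rw [indicator_of_mem]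
          simp [hn]
        · intro k hk
          rw [indicator_of_notMem]
          simpa [hn] using hk.symm
    rw [lintegral_congr_ae e1,
      lintegral_tsum fun k => (measurable_const.indicator (mk k)).aemeasurable] at hs
    simp_rw [lintegral_indicator_const (mk _)] at hs
    have h2 := ENNReal.hasSum_toReal (f := fun k : ℕ => ENNReal.ofReal s ^ k * Q {x | N x = k})
      (by rw [hs]; simp)
    have h3 : ∑' k : ℕ, (ENNReal.ofReal s ^ k * Q {x | N x = k}).toReal = G s := by
      rw [← ENNReal.tsum_toReal_eq
        (fun k => ENNReal.mul_ne_top (by simp) (measure_ne_top _ _)), hs,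
        ENNReal.toReal_ofReal (hG0 s)]
    rw [h3] at h2
    refine h2.congr_fun fun k => ?_
    rw [ENNReal.toReal_mul, ENNReal.toReal_pow, ENNReal.toReal_ofReal h0.le, mul_comm]
    rfl
  have hq : ∀ k : ℕ, Q.real {x | N x = k} = p k := by
    intro k
    rw [← sub_eq_zero]
    refine eq_zero_of_hasSum_pow_zero (d := fun k : ℕ => Q.real {x | N x = k} - p k)
      (fun s h0 h1 => ?_) k
    simpa [sub_mul] using (key s h0 h1).sub (hp s)
  -- Convergence for every real `s` is inherited from the series of `p`.
  refine ⟨fun s => ?_, hq⟩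
  simp_rw [hq]
  exact hp s

end Uniqueness

/-! ### Power series of the generating functions -/

section Expansions

/-- Expansion of a mixture of Poisson generating functions. -/
theorem hasSum_integral_exp_mul_sub_one {φ : ℝ → ℝ} (hφ : Continuous φ) (b s : ℝ) :
    HasSum (fun n : ℕ => (∫ x in (0 : ℝ)..b, φ x ^ n * Real.exp (-φ x)) / n.factorial * s ^ n)
      (∫ x in (0 : ℝ)..b, Real.exp (φ x * (s - 1))) := by
  have hexp : ∀ y : ℝ, HasSum (fun n : ℕ => y ^ n / n.factorial) (Real.exp y) := fun y => by
    rw [Real.exp_eq_exp_ℝ]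
    exact NormedSpace.expSeries_div_hasSum_exp y
  have hb : ∀ x, HasSum (fun n : ℕ => |φ x * s| ^ n / n.factorial * Real.exp (-φ x))
      (Real.exp |φ x * s| * Real.exp (-φ x)) := fun x => (hexp _).mul_right _
  have h := intervalIntegral.hasSum_integral_of_dominated_convergence (μ := volume) (a := 0) (b := b)
    (F := fun (n : ℕ) x => (φ x * s) ^ n / n.factorial * Real.exp (-φ x))
    (f := fun x => Real.exp (φ x * (s - 1)))
    (fun (n : ℕ) x => |φ x * s| ^ n / n.factorial * Real.exp (-φ x))
    (fun n => Continuous.aestronglyMeasurable (by fun_prop))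
    (fun n => .of_forall fun x _ => ?_) (.of_forall fun x _ => (hb x).summable) ?_
    (.of_forall fun x _ => ?_)
  · refine h.congr_fun fun n => ?_
    rw [div_mul_eq_mul_div, ← intervalIntegral.integral_mul_const,
      ← intervalIntegral.integral_div]
    congr 1
    funext x
    rw [mul_pow]
    ring
  · rw [norm_mul, norm_div, norm_pow, Real.norm_eq_abs, Real.norm_eq_abs, Real.norm_eq_abs,
      Real.abs_exp, Nat.abs_cast]
  · simp_rw [(hb _).tsum_eq]
    exact Continuous.intervalIntegrable (by fun_prop) _ _
  · have := (hexp (φ x * s)).mul_right (Real.exp (-φ x))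
    rwa [← Real.exp_add, show φ x * s + -φ x = φ x * (s - 1) by ring] at this

theorem continuous_mul_overlapBar (m r a : ℝ) : Continuous fun x => m * overlapBar r a x :=
  continuous_const.mul ((continuous_overlapBar a).comp (continuous_const.prodMk continuous_id))

variable {lamP m a r : ℝ}

theorem mcpExponentDeriv_eq (i : ℕ) : mcpExponentDeriv lamP m a i r = 2 * lamP *
    ∫ x in (0 : ℝ)..(r + a), (m * overlapBar r a x) ^ i * Real.exp (-(m * overlapBar r a x)) := by
  rw [mcpExponentDeriv, ← intervalIntegral.integral_const_mul]
  simp_rw [mul_assoc]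

/-- Subtracting the value at `s = 0` removes the constant coefficient, as `hasSum_exp_powerSeries`
requires; it returns as the prefactor of `mcpPMF`. -/
theorem hasSum_mcpExponent (s : ℝ) :
    HasSum (fun k : ℕ => (if k = 0 then 0 else
      mcpExponentDeriv lamP m a k r / k.factorial) * s ^ k)
      (mcpExponent lamP m a s r - mcpExponent lamP m a 0 r) := by
  have h := ((hasSum_integral_exp_mul_sub_one (continuous_mul_overlapBar m r a) (r + a) s).mul_left
    (2 * lamP)).sub (hasSum_ite_eq (0 : ℕ) (2 * lamP *
      ∫ x in (0 : ℝ)..(r + a), Real.exp (-(m * overlapBar r a x))))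
  have e : mcpExponent lamP m a s r - mcpExponent lamP m a 0 r =
      2 * lamP * (∫ x in (0 : ℝ)..(r + a), Real.exp (m * overlapBar r a x * (s - 1))) -
      2 * lamP * ∫ x in (0 : ℝ)..(r + a), Real.exp (-(m * overlapBar r a x)) := by
    simp only [mcpExponent, zero_sub, mul_neg, mul_one]
    ring
  rw [e]
  refine h.congr_fun fun k => ?_
  rcases k with _ | k
  · simp
  · simp only [Nat.succ_ne_zero, if_false, mcpExponentDeriv_eq, sub_zero]
    ring

theorem hasSum_mcpPMF (hl : 0 < lamP) (hm : 0 < m) (ha : 0 < a) (hr : 0 < r) (s : ℝ) :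
    HasSum (fun k => mcpPMF lamP m a r k * s ^ k) (Real.exp (mcpExponent lamP m a s r)) := by
  have h := (hasSum_exp_powerSeries (c := fun k : ℕ => if k = 0 then 0 else
      mcpExponentDeriv lamP m a k r / k.factorial) (by simp) (fun k => ?_)
      hasSum_mcpExponent s).mul_left (Real.exp (mcpExponent lamP m a 0 r))
  · rw [← Real.exp_add, add_sub_cancel] at h
    refine h.congr_fun fun k => ?_
    rw [mcpPMF, ← mul_assoc, Finset.mul_sum, Finset.mul_sum]
    congr 1
    refine Finset.sum_congr rfl fun b _ => ?_
    simp only [Nat.succ_ne_zero, if_false]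
    rw [Finset.prod_div_distrib]
    field_simp
  · split_ifs
    · exact le_rfl
    · refine div_nonneg ?_ (Nat.cast_nonneg _)
      rw [mcpExponentDeriv_eq]
      refine mul_nonneg (by positivity)
        (intervalIntegral.integral_nonneg (by positivity) fun x _ => ?_)
      exact mul_nonneg (pow_nonneg (mul_nonneg hm.le (overlapBar_nonneg ha r x)) _)
        (Real.exp_pos _).le

end Expansions

/-! ### Closed forms on the half-line -/

section ClosedForms

variable {lamP m a r : ℝ}

/-- The overlap is even in `x` and vanishes for `x ≥ r + a`, so the integral over the line is twice
one over `[0, r + a]`. -/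
theorem clusterExponent_eq (lamP m : ℝ) (ha : 0 < a) (hr : 0 < r) (t : ℝ) :
    -(lamP * clusterExponent m a t r) = mcpExponent lamP m a (Real.exp (-t)) r := by
  let f : ℝ → ℝ := fun x => 1 - Real.exp (-(m * ((1 - Real.exp (-t)) * overlapBar r a x)))
  have h1 : clusterExponent m a t r = 2 * ∫ x in Ioi (0 : ℝ), f x := by
    rw [← integral_comp_abs]
    simp only [f, overlapBar_abs]
    rfl
  have h2 : ∫ x in Ioi (0 : ℝ), f x = ∫ x in (0 : ℝ)..(r + a), f x := by
    rw [intervalIntegral.integral_of_le (by positivity)]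
    refine setIntegral_eq_of_subset_of_forall_sdiff_eq_zero measurableSet_Ioi
      Ioc_subset_Ioi_self fun x hx => ?_
    have : r + a ≤ x := by
      by_contra hlt
      exact hx.2 ⟨hx.1, (not_le.1 hlt).le⟩
    simp [f, overlapBar_eq_zero this]
  have h3 : ∫ x in (0 : ℝ)..(r + a), f x = (r + a) -
      ∫ x in (0 : ℝ)..(r + a), Real.exp (m * overlapBar r a x * (Real.exp (-t) - 1)) := by
    simp only [f]
    rw [intervalIntegral.integral_sub (by simp)
      ((continuous_exp_overlapBar_right m a t r).intervalIntegrable _ _)]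
    simp only [intervalIntegral.integral_const, sub_zero, smul_eq_mul, mul_one]
    congr 2
    funext x
    ring_nf
  rw [h1, h2, h3, mcpExponent]
  ring

theorem ownClusterTransform_eq (m : ℝ) (ha : 0 < a) (r t : ℝ) :
    ownClusterTransform m a t r =
      (∫ x in (0 : ℝ)..a, Real.exp (m * overlapBar r a x * (Real.exp (-t) - 1))) / a := by
  let f : ℝ → ℝ := fun x => Real.exp (m * overlapBar r a x * (Real.exp (-t) - 1))
  have hf : Continuous f := by
    have := continuous_mul_overlapBar m r a
    fun_prop
  have e : ∀ u, Real.exp (-(m * ((1 - Real.exp (-t)) * overlapBar r a u))) = f u := by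
    intro u
    simp only [f]
    ring_nf
  have hneg : ∫ x in (-a)..0, f x = ∫ x in (0 : ℝ)..a, f x := by
    have := intervalIntegral.integral_comp_neg (a := 0) (b := a) f
    rw [neg_zero] at this
    rw [← this]
    simp only [f, overlapBar_neg]
  have hsplit : ∫ x in (-a)..a, f x = 2 * ∫ x in (0 : ℝ)..a, f x := by
    rw [← intervalIntegral.integral_add_adjacent_intervals (hf.intervalIntegrable (-a) 0)
      (hf.intervalIntegrable 0 a), hneg]
    ring
  rw [ownClusterTransform]
  simp_rw [e]
  rw [ProbabilityTheory.cond, integral_smul_measure, Real.volume_closedBall, Real.closedBall_eq_Icc,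
    zero_sub, zero_add, integral_Icc_eq_integral_Ioc,
    ← intervalIntegral.integral_of_le (by linarith), hsplit, ENNReal.toReal_inv,
    ENNReal.toReal_ofReal (by positivity), smul_eq_mul]
  field_simp
  rfl

theorem hasSum_ownCluster (m r a s : ℝ) :
    HasSum (fun n : ℕ => (1 / a * ∫ x in (0 : ℝ)..a, (m * overlapBar r a x) ^ n *
        Real.exp (-(m * overlapBar r a x))) / n.factorial * s ^ n)
      ((∫ x in (0 : ℝ)..a, Real.exp (m * overlapBar r a x * (s - 1))) / a) := by
  refine ((hasSum_integral_exp_mul_sub_one (continuous_mul_overlapBar m r a) a s).div_const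
    a).congr_fun fun n => ?_
  ring

/-- The Cauchy product of the sibling factor with the cluster series; the binomial form is `1 / n! =
(k.choose n) (k - n)! / k!`. -/
theorem hasSum_connectivityDegree (hl : 0 < lamP) (hm : 0 < m) (ha : 0 < a) (hr : 0 < r) (s : ℝ) :
    HasSum (fun k : ℕ => (1 / (k.factorial : ℝ) * ∑ n ∈ Finset.range (k + 1),
        (k.choose n : ℝ) * ((k - n).factorial : ℝ) * mcpPMF lamP m a r (k - n) *
          (1 / a * ∫ x in (0 : ℝ)..a, (m * overlapBar r a x) ^ n *
            Real.exp (-(m * overlapBar r a x)))) * s ^ k)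
      (Real.exp (mcpExponent lamP m a s r) *
        ((∫ x in (0 : ℝ)..a, Real.exp (m * overlapBar r a x * (s - 1))) / a)) := by
  rw [mul_comm (Real.exp _)]
  refine (hasSum_mul_antidiagonal (hasSum_ownCluster m r a) (hasSum_mcpPMF hl hm ha hr)
    s).congr_fun fun k => ?_
  congr 1
  rw [Finset.Nat.sum_antidiagonal_eq_sum_range_succ (fun n j => (1 / a * ∫ x in (0 : ℝ)..a,
    (m * overlapBar r a x) ^ n * Real.exp (-(m * overlapBar r a x))) / n.factorial *
      mcpPMF lamP m a r j), Finset.mul_sum]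
  refine Finset.sum_congr rfl fun n hn => ?_
  have hk : (k.factorial : ℝ) = k.choose n * n.factorial * (k - n).factorial := by
    exact_mod_cast (Nat.choose_mul_factorial_mul_factorial
      (Nat.lt_succ_iff.1 (Finset.mem_range.1 hn))).symm
  have h1 : (k.choose n : ℝ) ≠ 0 := by
    exact_mod_cast (Nat.choose_pos (Nat.lt_succ_iff.1 (Finset.mem_range.1 hn))).ne'
  rw [hk]
  field_simp

theorem hasSum_poisson (c s : ℝ) :
    HasSum (fun k : ℕ => 1 / (k.factorial : ℝ) * c ^ k * Real.exp (-c) * s ^ k)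
      (Real.exp (c * (s - 1))) := by
  have h := (NormedSpace.expSeries_div_hasSum_exp (c * s : ℝ)).mul_right (Real.exp (-c))
  rw [← Real.exp_eq_exp_ℝ, ← Real.exp_add, show c * s + -c = c * (s - 1) by ring] at h
  refine h.congr_fun fun k => ?_
  rw [mul_pow]
  ring

end ClosedForms

/-! ### Integer-valued counts and the typical point -/

theorem exists_enat_tsum_indicator {Ω ι : Type*} (A : ι → Set Ω) (f : ι → Ω → ℝ) (D : Set ℝ)
    (ω : Ω) : ∃ n : ℕ∞,
      ∑' i, (A i).indicator (fun ω' => D.indicator (1 : ℝ → ℝ≥0∞) (f i ω')) ω = n := by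
  refine ⟨{i | ω ∈ A i ∧ f i ω ∈ D}.encard, ?_⟩
  rw [← ENNReal.tsum_set_one, tsum_subtype _ (fun _ => (1 : ℝ≥0∞))]
  congr with i
  by_cases h1 : ω ∈ A i <;> by_cases h2 : f i ω ∈ D <;> simp [indicator, h1, h2]

namespace PointProcess

variable {Ω : Type*} [MeasurableSpace Ω] {ι : Type*}

theorem exists_enat_config (Φ : PointProcess Ω ι) {D : Set ℝ} (hD : MeasurableSet D) (ω : Ω) :
    ∃ n : ℕ∞, Φ.config ω D = n := by
  rw [Φ.config_apply hD]
  exact exists_enat_tsum_indicator _ _ D ω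

theorem ae_reducedPalm_exists_enat [Countable ι] (Φ : PointProcess Ω ι) (P : Measure Ω)
    (B : Set ℝ) (Rb : ℝ) :
    ∀ᵐ μ ∂(Φ.reducedPalm P B), ∃ n : ℕ∞, connectivityDegree Rb μ = n := by
  have hm : MeasurableSet {μ | ∃ n : ℕ∞, connectivityDegree Rb μ = n} := by
    have h1 : MeasurableSet (range ((↑) : ℕ∞ → ℝ≥0∞)) := (countable_range _).measurableSet
    convert measurable_connectivityDegree Rb h1 using 1
    ext μ
    simp [eq_comm]
  refine Measure.ae_smul_measure ?_ _
  rw [Measure.ae_sum_iff]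
  intro i
  rw [ae_map_iff (Φ.measurable_othersSeenFrom i).aemeasurable hm]
  refine .of_forall fun ω => ?_
  rw [connectivityDegree, Φ.othersSeenFrom_apply i ω measurableSet_closedBall]
  exact exists_enat_tsum_indicator (fun j : {j // j ≠ i} => Φ.present j)
    (fun j ω' => Φ.loc j ω' - Φ.loc i ω') _ ω

/-- The connectivity degree of the typical point, from the transform of the number of
neighbours. -/
theorem connectivityDegree_of_neighbourLaplace [Countable ι] (Φ : PointProcess Ω ι)
    (P : Measure Ω) {Rb d : ℝ} (hd : 0 < d) {B : Set ℝ} (hB : MeasurableSet B)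
    (hB_pos : volume B ≠ 0) (hB_fin : volume B ≠ ∞) {G : ℝ → ℝ} {p : ℕ → ℝ}
    (hG0 : ∀ s, 0 ≤ G s) (hG1 : G 1 = 1) (hp : ∀ s : ℝ, HasSum (fun k => p k * s ^ k) (G s))
    (h : ∀ t, 0 ≤ t → Φ.neighbourLaplace P (ENNReal.ofReal t) (Rb / 2) B =
      volume B * ENNReal.ofReal (d * G (Real.exp (-t)))) :
    IsProbabilityMeasure (Φ.reducedPalm P B) ∧
      HasPGF (Φ.reducedPalm P B) (connectivityDegree Rb) G ∧
      HasPMF (Φ.reducedPalm P B) (connectivityDegree Rb) p := by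
  -- At `t = 0` the transform counts the points of the window, so `d` is the intensity and the
  -- normalization cancels it together with `volume B`.
  have hmean : Φ.meanCount P B = volume B * ENNReal.ofReal d := by
    have h0 := h 0 le_rfl
    rw [ENNReal.ofReal_zero, ← Φ.meanCount_eq_neighbourLaplace P _ hB, neg_zero, Real.exp_zero,
      hG1, mul_one] at h0
    exact h0
  have hd0 : ENNReal.ofReal d ≠ 0 := by simpa using hd
  have hm0 : Φ.meanCount P B ≠ 0 := hmean ▸ mul_ne_zero hB_pos hd0
  have hm1 : Φ.meanCount P B ≠ ∞ := hmean ▸ ENNReal.mul_ne_top hB_fin ENNReal.ofReal_ne_top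
  have hprob := Φ.isProbabilityMeasure_reducedPalm P hm0 hm1 hB
  refine ⟨hprob, hasPGF_and_hasPMF_of_lintegral_expNeg (measurable_connectivityDegree Rb)
    (Φ.ae_reducedPalm_exists_enat P B Rb) hG0 hp fun t ht => ?_⟩
  rw [Φ.lintegral_reducedPalm, h t ht.le, ENNReal.ofReal_mul hd.le, ← mul_assoc (volume B),
    ← hmean, ← mul_assoc, ENNReal.inv_mul_cancel hm0 hm1, one_mul]

end PointProcess

theorem theorem7 {Ω : Type*} [MeasurableSpace Ω] (P : Measure Ω) [IsProbabilityMeasure P]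
    (Rb : ℝ) (hRb : 0 < Rb)
    (B : Set ℝ) (hB : MeasurableSet B) (hB_pos : volume B ≠ 0) (hB_fin : volume B ≠ ∞) :
    -- independent vehicles: Poisson process of density `lam`
    (∀ {ι : Type*} [Countable ι] (lam : ℝ), 0 < lam →
      ∀ Φv : PointProcess Ω ι, Φv.IsPoisson P lam →
        IsProbabilityMeasure (Φv.reducedPalm P B) ∧
        HasPGF (Φv.reducedPalm P B) (connectivityDegree Rb)
          (fun s => Real.exp (lam * Rb * (s - 1))) ∧
        HasPMF (Φv.reducedPalm P B) (connectivityDegree Rb)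
          (fun k => 1 / (k.factorial : ℝ) * (lam * Rb) ^ k * Real.exp (-(lam * Rb)))) ∧
    -- platoons: Matérn cluster process
    (∀ {κ : Type*} [Countable κ] (lamP m a : ℝ), 0 < lamP → 0 < m → 0 < a →
      ∀ M : MaternCluster P κ lamP m a,
        -- the number of points of the cluster process itself in a ball of length `Rb`
        (∀ c : ℝ,
          HasPGF P (fun ω => M.points.config ω (Metric.closedBall c (Rb / 2)))
            (fun s => Real.exp (mcpExponent lamP m a s (Rb / 2))) ∧
          HasPMF P (fun ω => M.points.config ω (Metric.closedBall c (Rb / 2)))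
            (mcpPMF lamP m a (Rb / 2))) ∧
        -- the connectivity degree of the typical vehicle
        IsProbabilityMeasure (M.points.reducedPalm P B) ∧
        HasPGF (M.points.reducedPalm P B) (connectivityDegree Rb)
          (fun s => Real.exp (mcpExponent lamP m a s (Rb / 2)) *
            ((∫ x in (0 : ℝ)..a, Real.exp (m * overlapBar (Rb / 2) a x * (s - 1))) / a)) ∧
        HasPMF (M.points.reducedPalm P B) (connectivityDegree Rb)
          (fun k => 1 / (k.factorial : ℝ) * ∑ n ∈ Finset.range (k + 1),
            (k.choose n : ℝ) * ((k - n).factorial : ℝ) * mcpPMF lamP m a (Rb / 2) (k - n) *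
              (1 / a * ∫ x in (0 : ℝ)..a,
                (m * overlapBar (Rb / 2) a x) ^ n *
                  Real.exp (-(m * overlapBar (Rb / 2) a x))))) := by
  refine ⟨fun {ι} _ lam hlam Φv hΦ => ?_, fun {κ} _ lamP m a hl hm ha M => ⟨fun c => ?_, ?_⟩⟩
  · refine Φv.connectivityDegree_of_neighbourLaplace P hlam hB hB_pos hB_fin
      (fun s => (Real.exp_pos _).le) (by simp) (hasSum_poisson (lam * Rb)) fun t ht => ?_
    rw [hΦ.neighbourLaplace_eq hlam ht _ hB hB_fin,
      Real.volume_real_closedBall (by positivity)]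
    congr 4
    ring
  · refine hasPGF_and_hasPMF_of_lintegral_expNeg
      (M.points.measurable_config_apply measurableSet_closedBall)
      (.of_forall fun ω => M.points.exists_enat_config measurableSet_closedBall ω)
      (fun s => (Real.exp_pos _).le) (hasSum_mcpPMF hl hm ha (half_pos hRb)) fun t ht => ?_
    rw [M.lintegral_expNeg_count hl hm ha ht.le, clusterExponent_eq lamP m ha (half_pos hRb)]
  -- The intensity of the daughters is `lamP * m`.
  · refine M.points.connectivityDegree_of_neighbourLaplace P (mul_pos hl hm) hB hB_pos hB_fin
      (fun s => mul_nonneg (Real.exp_pos _).le (div_nonneg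
        (intervalIntegral.integral_nonneg ha.le fun x _ => (Real.exp_pos _).le) ha.le))
      ?_ (hasSum_connectivityDegree hl hm ha (half_pos hRb)) fun t ht => ?_
    · simp [mcpExponent, ha.ne']
    · rw [M.neighbourLaplace_eq hl hm ha ht _ hB hB_fin,
        clusterExponent_eq lamP m ha (half_pos hRb), ownClusterTransform_eq m ha, mul_assoc]
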